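/- Let $p$ be a real number with $p>2/3$. Then there exists a function $\psi$ analytic in the open unit disk $\mathbb D$, $\psi(z)=\sum_{n\ge 0}\hat\psi(n)z^n$, such that the Hankel matrix $\Gamma_\psi=\{\hat\psi(j+k)\}_{j,k\ge 0}$ is a Schur multiplier of the Schatten--von Neumann class $\boldsymbol S_p$ of operators on $\ell^2$ (that is, for every matrix $\{b_{jk}\}_{j,k\ge 0}$ of an operator of class $\boldsymbol S_p$, the matrix $\{\hat\psi(j+k)b_{jk}\}_{j,k\ge 0}$ is also the matrix of an operator of class $\boldsymbol S_p$), but $\psi$ is not the Cauchy integral of a complex measure: there is no complex Borel measure $\mu$ on the unit circle $\mathbb T$ such that $$\psi(\zeta)=\int_{\mathbb T}\frac{d\mu(\tau)}{1-\bar\tau\zeta}\qquad\text{for all }\zeta\in\mathbb D.$$ -/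

import Mathlib

open scoped Matrix

noncomputable section

namespace HankelSchur

/-- The complex Hilbert space `ℓ²` of square summable sequences indexed by `ℕ`. -/
abbrev EllTwo : Type := lp (fun _ : ℕ => ℂ) 2

/-- The `n`-th singular value (`n = 0, 1, 2, …`) of a bounded operator `T` on `ℓ²`: the distance,
in operator norm, from `T` to the set of bounded operators of rank at most `n`. -/
def singularValue (T : EllTwo →L[ℂ] EllTwo) (n : ℕ) : ℝ :=
  sInf {c : ℝ | ∃ R : EllTwo →L[ℂ] EllTwo, (R : EllTwo →ₗ[ℂ] EllTwo).rank ≤ n ∧ c = ‖T - R‖}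

/-- `T` belongs to the Schatten--von Neumann class `S_p`, `0 < p < ∞`: its sequence of
singular values is in `ℓ^p`. -/
def IsSchatten (p : ℝ) (T : EllTwo →L[ℂ] EllTwo) : Prop :=
  Summable fun n : ℕ => singularValue T n ^ p

/-- `A = (a_{jk})` is the matrix of `T` in the standard orthonormal basis of `ℓ²`. -/
def IsMatrixOf (A : Matrix ℕ ℕ ℂ) (T : EllTwo →L[ℂ] EllTwo) : Prop :=
  ∀ j k : ℕ, (T (lp.single 2 k (1 : ℂ)) : ℕ → ℂ) j = A j k

/-- The infinite matrix `A` is the matrix of an operator of class `S_p`. -/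
def MemSchatten (p : ℝ) (A : Matrix ℕ ℕ ℂ) : Prop :=
  ∃ T : EllTwo →L[ℂ] EllTwo, IsMatrixOf A T ∧ IsSchatten p T

/-- `A` is a Schur multiplier of `S_p`: the entrywise product `A ⊙ B` is in `S_p`
whenever `B` is in `S_p`. -/
def IsSchurMultiplier (p : ℝ) (A : Matrix ℕ ℕ ℂ) : Prop :=
  ∀ B : Matrix ℕ ℕ ℂ, MemSchatten p B → MemSchatten p (A ⊙ B)

/-- The `n`-th Taylor coefficient of `ψ` at the origin. -/
def taylorCoeff (ψ : ℂ → ℂ) (n : ℕ) : ℂ :=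
  iteratedDeriv n ψ 0 / (n.factorial : ℂ)

/-- The Hankel matrix of `ψ`, with `(j, k)` entry the Taylor coefficient of `ψ` of order `j + k`. -/
def hankelMatrix (ψ : ℂ → ℂ) : Matrix ℕ ℕ ℂ :=
  Matrix.of fun j k => taylorCoeff ψ (j + k)

/-- The unit circle `{τ : |τ| = 1}` in `ℂ`, with its Borel σ-algebra. -/
abbrev UnitCircle : Type := Metric.sphere (0 : ℂ) 1

/-- The Cauchy integral `∫ (1 - conj τ * ζ)⁻¹ dμ(τ)` over the unit circle of a complex Borel
measure `μ`. -/
def cauchyIntegral (μ : MeasureTheory.ComplexMeasure UnitCircle) (ζ : ℂ) : ℂ :=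
  MeasureTheory.VectorMeasure.integral μ
    (fun τ : UnitCircle => (1 - (starRingEnd ℂ) (τ : ℂ) * ζ)⁻¹) (ContinuousLinearMap.mul ℝ ℂ)

/-- On the open unit disk, `φ` is the Cauchy integral of a complex Borel measure on the
unit circle. -/
def IsCauchyIntegralOfMeasure (φ : ℂ → ℂ) : Prop :=
  ∃ μ : MeasureTheory.ComplexMeasure UnitCircle,
    ∀ ζ ∈ Metric.ball (0 : ℂ) 1, φ ζ = cauchyIntegral μ ζ

end HankelSchur

end

open scoped Matrix InnerProductSpace

noncomputable section

namespace HankelSchur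

open MeasureTheory

/-! ### Singular values -/

/-! The symbol has coefficients `∑ₙ aₙ bumpₙ(j) nodeₙ ^ j` with `aₙ = 1 / (n + 1)`. The n-th bump `d
^ j - d ^ (2 j)`, `d = exp (-1 / scale n)`, lives on indices of order `2 ^ (n ^ 2)`, and the n-th
node is the point of the circle near `1` with imaginary part `2 ^ (-n)`.

Multiplier. Since `d ^ j` is multiplicative, a bump at `j + k` splits into two products, each with a
bump in one variable and a factor of modulus at most one in the other (`bump_add`). Hence the Schur
product of the Hankel matrix with `x ⊗ y` is a sum of rank one matrices of norm at most `aₙ ‖zₙ‖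
‖y‖`, where `zₙ` is `x` cut by the n-th bump, plus a symmetric sum. The bumps sum to at most one, so
`∑ ‖zₙ‖² ≤ ‖x‖²`, and Hölder bounds `∑ (aₙ ‖zₙ‖) ^ s` as soon as `a ∈ ℓ^q` with `1/s = 1/q + 1/2`.
For `aₙ = 1 / (n + 1)` this means `q > 1`, that is `s > 2/3`. So rank one matrices go to `ℓ^s` sums
of rank one matrices (`exists_atomicMultiplier_symbolMatrix`). Such sums lie in weak `S_s`, and an
interpolation between this estimate and boundedness on operators gives `S_p` for every `p > s`
(`AtomicMultiplier.isSchurMultiplier`).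

Not a Cauchy integral. The n-th test polynomial averages `conj (nodeₙ) ^ j` over `scale n ≤ j < 2
scale n`. Paired with the symbol it gives at least `c₀ aₙ - 4 · 2 ^ (-n)` (`le_norm_test_symbol`),
because the other scales are far away. At each point of the circle the moduli of all test
polynomials sum to at most an absolute constant (`sum_norm_test_le`), because the nodes are
separated. A representing measure would therefore bound `∑ aₙ`, which is the divergent harmonic
series. -/

lemma singularValue_bddBelow (T : EllTwo →L[ℂ] EllTwo) (n : ℕ) :
    BddBelow {c : ℝ | ∃ R : EllTwo →L[ℂ] EllTwo, (R : EllTwo →ₗ[ℂ] EllTwo).rank ≤ n ∧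
      c = ‖T - R‖} :=
  ⟨0, by rintro _ ⟨R, -, rfl⟩; exact norm_nonneg _⟩

lemma singularValue_nonempty (T : EllTwo →L[ℂ] EllTwo) (n : ℕ) :
    {c : ℝ | ∃ R : EllTwo →L[ℂ] EllTwo, (R : EllTwo →ₗ[ℂ] EllTwo).rank ≤ n ∧
      c = ‖T - R‖}.Nonempty :=
  ⟨_, 0, by simp [LinearMap.rank], rfl⟩

lemma singularValue_nonneg (T : EllTwo →L[ℂ] EllTwo) (n : ℕ) : 0 ≤ singularValue T n :=
  Real.sInf_nonneg (by rintro _ ⟨R, -, rfl⟩; exact norm_nonneg _)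

lemma singularValue_le_norm_sub {T R : EllTwo →L[ℂ] EllTwo} {n : ℕ}
    (hR : (R : EllTwo →ₗ[ℂ] EllTwo).rank ≤ n) : singularValue T n ≤ ‖T - R‖ :=
  csInf_le (singularValue_bddBelow T n) ⟨R, hR, rfl⟩

lemma exists_rank_le_norm_sub_lt {T : EllTwo →L[ℂ] EllTwo} {n : ℕ} {t : ℝ}
    (h : singularValue T n < t) :
    ∃ R : EllTwo →L[ℂ] EllTwo, (R : EllTwo →ₗ[ℂ] EllTwo).rank ≤ n ∧ ‖T - R‖ < t := by
  obtain ⟨_, ⟨R, hR, rfl⟩, hlt⟩ := exists_lt_of_csInf_lt (singularValue_nonempty T n) h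
  exact ⟨R, hR, hlt⟩

lemma singularValue_antitone (T : EllTwo →L[ℂ] EllTwo) : Antitone (singularValue T) := by
  intro m n hmn
  refine le_csInf (singularValue_nonempty T m) ?_
  rintro _ ⟨R, hR, rfl⟩
  exact singularValue_le_norm_sub (hR.trans (by exact_mod_cast hmn))

lemma singularValue_add_le_add_norm (S T : EllTwo →L[ℂ] EllTwo) (n : ℕ) :
    singularValue (S + T) n ≤ singularValue S n + ‖T‖ := by
  rw [← sub_le_iff_le_add]
  refine le_csInf (singularValue_nonempty S n) ?_
  rintro _ ⟨R, hR, rfl⟩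
  rw [sub_le_iff_le_add]
  refine (singularValue_le_norm_sub hR).trans ?_
  have : (S + T) - R = (S - R) + T := by abel
  rw [this]
  exact norm_add_le _ _

lemma rank_le_of_forall_mem {E : Type*} [NormedAddCommGroup E] [InnerProductSpace ℂ E]
    {T : E →L[ℂ] E} {K : Submodule ℂ E} [FiniteDimensional ℂ K] {n : ℕ}
    (hK : Module.finrank ℂ K ≤ n) (h : ∀ z, T z ∈ K) : (T : E →ₗ[ℂ] E).rank ≤ n := by
  have h' : LinearMap.range (T : E →ₗ[ℂ] E) ≤ K := by
    rintro _ ⟨z, rfl⟩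
    exact h z
  refine (Submodule.rank_mono h').trans ?_
  rw [← Module.finrank_eq_rank]
  exact_mod_cast hK

lemma rank_add_le_add {E : Type*} [NormedAddCommGroup E] [InnerProductSpace ℂ E]
    {S T : E →L[ℂ] E} {m n : ℕ} (hS : (S : E →ₗ[ℂ] E).rank ≤ m) (hT : (T : E →ₗ[ℂ] E).rank ≤ n) :
    ((S + T : E →L[ℂ] E) : E →ₗ[ℂ] E).rank ≤ (m + n : ℕ) := by
  rw [ContinuousLinearMap.toLinearMap_add, Nat.cast_add]
  exact (LinearMap.rank_add_le _ _).trans (add_le_add hS hT)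

lemma rank_comp_le {E : Type*} [NormedAddCommGroup E] [InnerProductSpace ℂ E]
    {S T : E →L[ℂ] E} {n : ℕ} (hT : (T : E →ₗ[ℂ] E).rank ≤ n) :
    ((S ∘L T : E →L[ℂ] E) : E →ₗ[ℂ] E).rank ≤ n := by
  rw [ContinuousLinearMap.toLinearMap_comp]
  exact (LinearMap.rank_comp_le_right _ _).trans hT

lemma rank_sub_le_add {E : Type*} [NormedAddCommGroup E] [InnerProductSpace ℂ E]
    {S T : E →L[ℂ] E} {m n : ℕ} (hS : (S : E →ₗ[ℂ] E).rank ≤ m) (hT : (T : E →ₗ[ℂ] E).rank ≤ n) :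
    ((S - T : E →L[ℂ] E) : E →ₗ[ℂ] E).rank ≤ (m + n : ℕ) := by
  have h : S - T = S + (-ContinuousLinearMap.id ℂ E) ∘L T := by
    ext z
    simp [sub_eq_add_neg]
  rw [h]
  exact rank_add_le_add hS (rank_comp_le hT)

/-! ### Weak-type estimates for sums of rank one operators -/

lemma hasSum_inner_of_hasSum_rankOne {E : Type*} [NormedAddCommGroup E] [InnerProductSpace ℂ E]
    {ι : Type*} {c : ι → ℝ} {x y : ι → E} {T : E →L[ℂ] E}
    (hT : HasSum (fun i => (c i : ℂ) • InnerProductSpace.rankOne ℂ (x i) (y i)) T) (w z : E) :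
    HasSum (fun i => (c i : ℂ) * (⟪y i, z⟫_ℂ * ⟪w, x i⟫_ℂ)) ⟪w, T z⟫_ℂ := by
  have := hT.mapL ((innerSL ℂ w).comp (ContinuousLinearMap.apply ℂ E z))
  simpa [inner_smul_right] using this

section Weak

variable {E : Type*} [NormedAddCommGroup E] [InnerProductSpace ℂ E]
  {ι : Type*} {c : ι → ℝ} {x y : ι → E}

lemma summable_mul_norm_inner_sq (hc : ∀ i, 0 ≤ c i) (hcs : Summable c) (hy : ∀ i, ‖y i‖ ≤ 1)
    (z : E) : Summable fun i => c i * ‖⟪y i, z⟫_ℂ‖ ^ 2 := by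
  refine Summable.of_nonneg_of_le (fun i => by have := hc i; positivity) (fun i => ?_)
    (hcs.mul_right (‖z‖ ^ 2))
  have h1 : ‖⟪y i, z⟫_ℂ‖ ≤ ‖z‖ :=
    (norm_inner_le_norm _ _).trans (mul_le_of_le_one_left (norm_nonneg _) (hy i))
  have := hc i
  gcongr

/-- Outside a subspace of dimension at most `n`, the quadratic form `z ↦ ∑ cᵢ |⟨yᵢ, z⟩|²` is at
most `λ ‖z‖²` as soon as `∑ cᵢ ≤ n λ`. -/
lemma exists_finrank_le_quadratic_le (hc : ∀ i, 0 ≤ c i) (hcs : Summable c)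
    (hy : ∀ i, ‖y i‖ ≤ 1) {n : ℕ} {l : ℝ} (hl : 0 < l) (hsum : ∑' i, c i ≤ n * l) :
    ∃ K : Submodule ℂ E, FiniteDimensional ℂ K ∧ Module.finrank ℂ K ≤ n ∧
      ∀ z ∈ Kᗮ, ∑' i, c i * ‖⟪y i, z⟫_ℂ‖ ^ 2 ≤ l * ‖z‖ ^ 2 := by
  classical
  set q : E → ℝ := fun z => ∑' i, c i * ‖⟪y i, z⟫_ℂ‖ ^ 2 with hq
  have hqs := summable_mul_norm_inner_sq hc hcs hy
  -- A maximal orthonormal family with `q f > l` spans the required subspace. By Bessel the values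
  -- of `q` on an orthonormal family sum to at most `∑ cᵢ ≤ n l`, so it has at most `n` members. A
  -- unit vector orthogonal to it with `q > l` would extend it.
  let P : Finset E → Prop := fun s => (∀ f ∈ s, ‖f‖ = 1) ∧
    (∀ f ∈ s, ∀ g ∈ s, f ≠ g → ⟪f, g⟫_ℂ = 0) ∧ ∀ f ∈ s, l < q f
  have hcard : ∀ s, P s → s.card ≤ n := by
    rintro s ⟨h1, h2, h3⟩
    have ho : Orthonormal ℂ (Subtype.val : s → E) :=
      ⟨fun f => h1 f f.2, fun f g hfg => h2 f f.2 g g.2 (fun h => hfg (Subtype.ext h))⟩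
    have hle : ∑ f ∈ s, q f ≤ n * l := by
      rw [hq, ← Summable.tsum_finsetSum (fun f _ => hqs f)]
      refine le_trans (Summable.tsum_le_tsum (fun i => ?_) (summable_sum fun f _ => hqs f) hcs)
        hsum
      rw [← Finset.mul_sum]
      refine mul_le_of_le_one_right (hc i) ?_
      have := ho.sum_inner_products_le (s := Finset.univ) (y i)
      have h5 : ∑ f ∈ s, ‖⟪y i, f⟫_ℂ‖ ^ 2 ≤ ‖y i‖ ^ 2 := by
        refine le_trans (le_of_eq ?_) this
        rw [← Finset.sum_coe_sort s]
        exact Finset.sum_congr rfl fun f _ => by rw [norm_inner_symm]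
      exact h5.trans (pow_le_one₀ (norm_nonneg _) (hy i))
    by_contra hlt
    push Not at hlt
    have hne : s.Nonempty := by
      rw [← Finset.card_pos]; omega
    have h4 : (s.card : ℝ) * l < ∑ f ∈ s, q f := by
      rw [← nsmul_eq_mul, ← Finset.sum_const]
      exact Finset.sum_lt_sum_of_nonempty hne h3
    have h5 : (n : ℝ) * l ≤ s.card * l := by
      gcongr
    linarith
  obtain ⟨s, hs, hmax⟩ : ∃ s, P s ∧ ∀ s', P s' → s'.card ≤ s.card := by
    have hex : ∃ m, m ≤ n ∧ ∃ s, P s ∧ s.card = m := ⟨0, by simp, ∅, by simp [P], by simp⟩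
    obtain ⟨m, ⟨s, hs, hm⟩, hmm⟩ : ∃ m, (∃ s, P s ∧ s.card = m) ∧
        ∀ m', (∃ s, P s ∧ s.card = m') → m' ≤ m := by
      refine ⟨Nat.findGreatest (fun m => ∃ s, P s ∧ s.card = m) n, ?_, ?_⟩
      · exact Nat.findGreatest_spec (P := fun m => ∃ s, P s ∧ s.card = m) (Nat.zero_le n)
          ⟨∅, by simp [P], by simp⟩
      · rintro m' ⟨s, hs, rfl⟩
        exact Nat.le_findGreatest (hcard s hs) ⟨s, hs, rfl⟩
    exact ⟨s, hs, fun s' hs' => hm ▸ hmm _ ⟨s', hs', rfl⟩⟩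
  refine ⟨Submodule.span ℂ (s : Set E), inferInstance,
    (finrank_span_finset_le_card s).trans (hcard s hs), fun z hz => ?_⟩
  by_contra hlt
  push Not at hlt
  have hz0 : z ≠ 0 := by
    rintro rfl
    simp at hlt
  have hzn : 0 < ‖z‖ := norm_pos_iff.mpr hz0
  set w : E := ((‖z‖ : ℂ)⁻¹) • z with hw
  have hwn : ‖w‖ = 1 := by
    rw [hw, norm_smul, norm_inv, Complex.norm_real, norm_norm, inv_mul_cancel₀ hzn.ne']
  have hwq : l < q w := by
    have : q w = q z / ‖z‖ ^ 2 := by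
      simp only [hq, div_eq_mul_inv, ← tsum_mul_right]
      refine tsum_congr fun i => ?_
      rw [hw, inner_smul_right, norm_mul, norm_inv, Complex.norm_real, norm_norm]
      ring
    rw [this, lt_div_iff₀ (by positivity)]
    exact hlt
  have hort : ∀ f ∈ s, ⟪f, w⟫_ℂ = 0 := fun f hf => by
    rw [hw, inner_smul_right, (Submodule.mem_orthogonal _ _).1 hz f (Submodule.subset_span hf),
      mul_zero]
  have hws : w ∉ s := fun h => by
    have := hort w h
    rw [inner_self_eq_zero] at this
    simp [this] at hwn
  have := hmax (insert w s) ⟨?_, ?_, ?_⟩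
  · rw [Finset.card_insert_of_notMem hws] at this
    omega
  · intro f hf
    rcases Finset.mem_insert.1 hf with rfl | hf
    exacts [hwn, hs.1 f hf]
  · intro f hf g hg hfg
    rcases Finset.mem_insert.1 hf with rfl | hf <;> rcases Finset.mem_insert.1 hg with rfl | hg
    · exact absurd rfl hfg
    · rw [← inner_conj_symm, hort g hg, map_zero]
    · exact hort f hf
    · exact hs.2.1 f hf g hg hfg
  · intro f hf
    rcases Finset.mem_insert.1 hf with rfl | hf
    exacts [hwq, hs.2.2 f hf]

/-- Let `K` and `J` be the exceptional subspaces of the quadratic forms of `y` and of `x`. By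
Cauchy–Schwarz in AM–GM form, `(1 - P_J) T (1 - P_K)` has norm at most `l`, and it differs from `T`
by an operator of rank at most `2 n`. -/
lemma exists_rank_le_norm_sub_le (hc : ∀ i, 0 ≤ c i) (hcs : Summable c)
    (hx : ∀ i, ‖x i‖ ≤ 1) (hy : ∀ i, ‖y i‖ ≤ 1) {T : E →L[ℂ] E}
    (hT : HasSum (fun i => (c i : ℂ) • InnerProductSpace.rankOne ℂ (x i) (y i)) T)
    {n : ℕ} {l : ℝ} (hl : 0 < l) (hsum : ∑' i, c i ≤ n * l) :
    ∃ R : E →L[ℂ] E, (R : E →ₗ[ℂ] E).rank ≤ (2 * n : ℕ) ∧ ‖T - R‖ ≤ l := by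
  obtain ⟨K, hKf, hKn, hK⟩ := exists_finrank_le_quadratic_le hc hcs hy hl hsum
  obtain ⟨J, hJf, hJn, hJ⟩ := exists_finrank_le_quadratic_le hc hcs hx hl hsum
  have hTz := fun w z => hasSum_inner_of_hasSum_rankOne hT w z
  have key : ∀ z ∈ Kᗮ, ∀ w ∈ Jᗮ, 2 * ‖⟪w, T z⟫_ℂ‖ ≤ l * ‖z‖ ^ 2 + l * ‖w‖ ^ 2 := by
    intro z hz w hw
    refine le_trans ?_ (add_le_add (hK z hz) (hJ w hw))
    have hs1 := summable_mul_norm_inner_sq hc hcs hy z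
    have hs2 := summable_mul_norm_inner_sq hc hcs hx w
    rw [← hs1.tsum_add hs2, ← (hTz w z).tsum_eq]
    have hle : ∀ i, ‖(c i : ℂ) * (⟪y i, z⟫_ℂ * ⟪w, x i⟫_ℂ)‖ ≤
        (c i * ‖⟪y i, z⟫_ℂ‖ ^ 2 + c i * ‖⟪x i, w⟫_ℂ‖ ^ 2) / 2 := by
      intro i
      rw [norm_mul, norm_mul, Complex.norm_real, Real.norm_of_nonneg (hc i), norm_inner_symm w]
      nlinarith [mul_nonneg (hc i) (sq_nonneg (‖⟪y i, z⟫_ℂ‖ - ‖⟪x i, w⟫_ℂ‖))]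
    have := tsum_of_norm_bounded ((hs1.add hs2).div_const 2).hasSum hle
    rw [tsum_div_const] at this
    linarith
  set R : E →L[ℂ] E := J.starProjection ∘L T +
    (T - J.starProjection ∘L T) ∘L K.starProjection with hR
  have hrank : (R : E →ₗ[ℂ] E).rank ≤ (2 * n : ℕ) := by
    rw [two_mul, hR]
    refine rank_add_le_add (rank_le_of_forall_mem hJn fun z => J.starProjection_apply_mem _)
      (rank_comp_le (rank_le_of_forall_mem hKn fun z => K.starProjection_apply_mem _))
  refine ⟨R, hrank, ContinuousLinearMap.opNorm_le_bound _ hl.le ?_⟩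
  intro z
  set z' := z - K.starProjection z with hz'
  have hz'm : z' ∈ Kᗮ := K.sub_starProjection_mem_orthogonal z
  have hz'n : ‖z'‖ ≤ ‖z‖ := by
    rw [hz', ← Submodule.starProjection_orthogonal_val]
    exact Submodule.norm_starProjection_apply_le _ _
  set w := T z' - J.starProjection (T z') with hw
  have hwm : w ∈ Jᗮ := J.sub_starProjection_mem_orthogonal _
  have hval : (T - R) z = w := by
    simp only [hR, hw, hz', sub_apply, add_apply,
      ContinuousLinearMap.comp_apply, map_sub]
    abel
  have hin : ⟪w, T z'⟫_ℂ = (‖w‖ : ℂ) ^ 2 := by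
    have h1 : T z' = w + J.starProjection (T z') := by rw [hw]; abel
    rw [h1, inner_add_right, inner_self_eq_norm_sq_to_K,
      (Submodule.mem_orthogonal' _ _).1 hwm _ (J.starProjection_apply_mem _), add_zero]
    rfl
  -- The factor `l⁻¹` balances the two terms: the inequality becomes `2 l⁻¹ ‖w‖² ≤ l ‖z'‖² + l⁻¹
  -- ‖w‖²`.
  have h2 := key z' hz'm (((l⁻¹ : ℝ) : ℂ) • w) (Jᗮ.smul_mem _ hwm)
  rw [inner_smul_left, hin, norm_smul, norm_mul, Complex.conj_ofReal, Complex.norm_real, norm_pow,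
    Complex.norm_real, norm_norm, Real.norm_of_nonneg (by positivity)] at h2
  have h3 : ‖w‖ ^ 2 ≤ (l * ‖z‖) ^ 2 := by
    have h4 : l * (l⁻¹ * ‖w‖) ^ 2 = l⁻¹ * ‖w‖ ^ 2 := by field_simp
    rw [h4] at h2
    have h5 : l⁻¹ * ‖w‖ ^ 2 ≤ l * ‖z'‖ ^ 2 := by linarith
    have h6 : ‖w‖ ^ 2 ≤ l * (l * ‖z'‖ ^ 2) := by
      rwa [inv_mul_le_iff₀ hl] at h5
    calc ‖w‖ ^ 2 ≤ l * (l * ‖z'‖ ^ 2) := h6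
      _ ≤ l * (l * ‖z‖ ^ 2) := by gcongr
      _ = _ := by ring
  rw [hval]
  exact le_of_sq_le_sq h3 (by positivity)

end Weak

lemma hasSum_of_forall_eq {ι M : Type*} [AddCommMonoid M] [TopologicalSpace M] {f g : ι → M} {a : M}
    (h : ∀ i, f i = g i) (hg : HasSum g a) : HasSum f a := by
  rwa [funext h]

lemma le_rpow_mul_rpow_one_sub {c l s : ℝ} (hc : 0 ≤ c) (hcl : c ≤ l) (hs : s ≤ 1) :
    c ≤ c ^ s * l ^ (1 - s) := by
  rcases hc.eq_or_lt with rfl | hc'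
  · positivity
  calc c = c ^ s * c ^ (1 - s) := by
        rw [← Real.rpow_add hc', add_sub_cancel, Real.rpow_one]
    _ ≤ c ^ s * l ^ (1 - s) := by
        gcongr

/-- The embedding of `ℓ^s` into `ℓ^1` for `0 < s ≤ 1`. -/
lemma summable_and_tsum_le_of_rpow {ι : Type*} {c : ι → ℝ} {s M : ℝ} (hs : 0 < s) (hs1 : s ≤ 1)
    (hc : ∀ i, 0 ≤ c i) (hcs : Summable fun i => c i ^ s) (hM : ∑' i, c i ^ s ≤ M) :
    Summable c ∧ ∑' i, c i ≤ M ^ (1 / s) := by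
  have hM0 : 0 ≤ M := (tsum_nonneg fun i => Real.rpow_nonneg (hc i) s).trans hM
  set l := M ^ (1 / s) with hl
  have hl0 : 0 ≤ l := by positivity
  have hls : l ^ s = M := by
    rw [hl, ← Real.rpow_mul hM0, one_div_mul_cancel hs.ne', Real.rpow_one]
  have hcl : ∀ i, c i ≤ l := fun i => by
    rw [← Real.rpow_le_rpow_iff (hc i) hl0 hs, hls]
    exact (hcs.le_tsum i fun j _ => Real.rpow_nonneg (hc j) s).trans hM
  have hle := fun i => le_rpow_mul_rpow_one_sub (hc i) (hcl i) hs1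
  have hsum : Summable c := Summable.of_nonneg_of_le hc hle (hcs.mul_right _)
  refine ⟨hsum, (hsum.tsum_le_tsum hle (hcs.mul_right _)).trans ?_⟩
  rw [tsum_mul_right]
  calc (∑' i, c i ^ s) * l ^ (1 - s) ≤ M * l ^ (1 - s) := by gcongr
    _ = l ^ s * l ^ (1 - s) := by rw [hls]
    _ = l := by
      rw [← Real.rpow_add_of_nonneg hl0 hs.le (by linarith), add_sub_cancel, Real.rpow_one]

section Weak

variable {E : Type*} [NormedAddCommGroup E] [InnerProductSpace ℂ E] {ι : Type*} {x y : ι → E}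

lemma norm_inv_norm_smul_le (v : E) : ‖(‖v‖ : ℂ)⁻¹ • v‖ ≤ 1 := by
  rw [norm_smul, norm_inv, Complex.norm_real, norm_norm]
  exact inv_mul_le_one

lemma norm_smul_inv_norm_smul (v : E) : (‖v‖ : ℂ) • ((‖v‖ : ℂ)⁻¹ • v) = v := by
  rcases eq_or_ne v 0 with rfl | hv
  · simp
  · rw [smul_smul, mul_inv_cancel₀ (by simpa using hv), one_smul]

lemma rankOne_smul_smul (a b : ℝ) (v w : E) :
    InnerProductSpace.rankOne ℂ ((a : ℂ) • v) ((b : ℂ) • w) =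
      ((a * b : ℝ) : ℂ) • InnerProductSpace.rankOne ℂ v w := by
  ext z
  simp only [InnerProductSpace.rankOne_apply, smul_apply, inner_smul_left, smul_smul,
    Complex.conj_ofReal, Complex.ofReal_mul]
  congr 1
  ring

lemma smul_rankOne_normalize (v w : E) :
    ((‖v‖ * ‖w‖ : ℝ) : ℂ) •
      InnerProductSpace.rankOne ℂ ((‖v‖ : ℂ)⁻¹ • v) ((‖w‖ : ℂ)⁻¹ • w) =
      InnerProductSpace.rankOne ℂ v w := by
  rw [← rankOne_smul_smul, norm_smul_inv_norm_smul, norm_smul_inv_norm_smul]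

lemma rank_rankOne_le (v w : E) :
    (InnerProductSpace.rankOne ℂ v w : E →ₗ[ℂ] E).rank ≤ (1 : ℕ) := by
  refine rank_le_of_forall_mem (K := Submodule.span ℂ (({v} : Finset E) : Set E))
    (finrank_span_finset_le_card {v}) fun z => ?_
  rw [InnerProductSpace.rankOne_apply]
  exact Submodule.smul_mem _ _ (Submodule.subset_span (by simp))

lemma rank_sum_rankOne_le (F : Finset ι) (x y : ι → E) :
    ((∑ i ∈ F, InnerProductSpace.rankOne ℂ (x i) (y i) : E →L[ℂ] E) : E →ₗ[ℂ] E).rank ≤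
      (F.card : ℕ) := by
  classical
  induction F using Finset.induction_on with
  | empty => exact rank_le_of_forall_mem (K := ⊥) (by simp) (by simp)
  | insert a F ha ih =>
    rw [Finset.sum_insert ha, Finset.card_insert_of_notMem ha, add_comm]
    exact rank_add_le_add ih (rank_rankOne_le _ _)

/-- If `T = ∑ xᵢ ⊗ yᵢ` with `∑ (‖xᵢ‖ ‖yᵢ‖) ^ s ≤ n l ^ s`, then `T` is at distance at most `l` from
the operators of rank at most `3 n`. -/
lemma exists_rank_le_norm_sub_le_of_rpow {s : ℝ} (hs : 0 < s) (hs1 : s ≤ 1)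
    (hsum : Summable fun i => (‖x i‖ * ‖y i‖) ^ s) {T : E →L[ℂ] E}
    (hT : HasSum (fun i => InnerProductSpace.rankOne ℂ (x i) (y i)) T)
    {n : ℕ} {l : ℝ} (hl : 0 < l) (hn : ∑' i, (‖x i‖ * ‖y i‖) ^ s ≤ n * l ^ s) :
    ∃ R : E →L[ℂ] E, (R : E →ₗ[ℂ] E).rank ≤ (3 * n : ℕ) ∧ ‖T - R‖ ≤ l := by
  classical
  set c : ι → ℝ := fun i => ‖x i‖ * ‖y i‖ with hc
  have hc0 : ∀ i, 0 ≤ c i := fun i => by positivity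
  have hls : 0 < l ^ s := by positivity
  -- The atoms larger than `l` number at most `n` and are removed exactly. For the others `c ≤ c ^ s
  -- l ^ (1 - s)`, so they sum to at most `n l` and cost rank `2 n`: hence `3 n`.
  have hfin : {i | l < c i}.Finite := by
    have h1 : ∀ᶠ i in Filter.cofinite, c i ^ s < l ^ s :=
      hsum.tendsto_cofinite_zero.eventually (gt_mem_nhds hls)
    refine Set.Finite.subset (Filter.eventually_cofinite.1 h1) fun i hi => ?_
    simp only [Set.mem_ofPred_eq, not_lt] at hi ⊢
    exact Real.rpow_le_rpow hl.le hi.le hs.le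
  set F := hfin.toFinset with hF
  have hmem : ∀ i, i ∈ F ↔ l < c i := fun i => by simp [hF]
  have hcard : F.card ≤ n := by
    have h1 : (F.card : ℝ) * l ^ s ≤ n * l ^ s := by
      refine le_trans ?_ hn
      refine le_trans ?_ (hsum.sum_le_tsum F fun i _ => Real.rpow_nonneg (hc0 i) s)
      rw [← nsmul_eq_mul]
      refine Finset.card_nsmul_le_sum _ _ _ fun i hi => ?_
      exact Real.rpow_le_rpow hl.le ((hmem i).1 hi).le hs.le
    exact_mod_cast le_of_mul_le_mul_right h1 hls
  set c' : ι → ℝ := fun i => if i ∈ F then 0 else c i with hc'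
  have hc'0 : ∀ i, 0 ≤ c' i := fun i => by
    simp only [hc']; split_ifs; exacts [le_rfl, hc0 i]
  have hc'l : ∀ i, c' i ≤ c i ^ s * l ^ (1 - s) := fun i => by
    simp only [hc']
    split_ifs with h
    · have := hc0 i; positivity
    · rw [hmem, not_lt] at h
      exact le_rpow_mul_rpow_one_sub (hc0 i) h hs1
  have hc's : Summable c' := Summable.of_nonneg_of_le hc'0 hc'l (hsum.mul_right _)
  have hc'n : ∑' i, c' i ≤ n * l := by
    refine (hc's.tsum_le_tsum hc'l (hsum.mul_right _)).trans ?_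
    rw [tsum_mul_right]
    calc (∑' i, c i ^ s) * l ^ (1 - s) ≤ n * l ^ s * l ^ (1 - s) := by gcongr
      _ = n * l := by
        rw [mul_assoc, ← Real.rpow_add hl, add_sub_cancel, Real.rpow_one]
  set S : E →L[ℂ] E := ∑ i ∈ F, InnerProductSpace.rankOne ℂ (x i) (y i) with hS
  have hrest : HasSum (fun i => (c' i : ℂ) • InnerProductSpace.rankOne ℂ ((‖x i‖ : ℂ)⁻¹ • x i)
      ((‖y i‖ : ℂ)⁻¹ • y i)) (T - S) := by
    have h1 : HasSum (fun i => if i ∈ F then InnerProductSpace.rankOne ℂ (x i) (y i) else 0) S := by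
      have := hasSum_sum_of_ne_finset_zero (L := .unconditional ι) (s := F)
        (f := fun i => if i ∈ F then InnerProductSpace.rankOne ℂ (x i) (y i) else 0)
        (fun i hi => if_neg hi)
      rwa [Finset.sum_congr rfl (fun i hi => if_pos hi)] at this
    refine hasSum_of_forall_eq (fun i => ?_) (hT.sub h1)
    simp only [hc']
    split_ifs
    · simp
    · rw [sub_zero, smul_rankOne_normalize]
  obtain ⟨R, hR, hRl⟩ := exists_rank_le_norm_sub_le hc'0 hc's
    (fun i => norm_inv_norm_smul_le (x i)) (fun i => norm_inv_norm_smul_le (y i)) hrest hl hc'n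
  refine ⟨S + R, ?_, ?_⟩
  · have : 3 * n = n + 2 * n := by ring
    rw [this]
    refine rank_add_le_add ((rank_sum_rankOne_le F x y).trans ?_) hR
    exact_mod_cast hcard
  · rwa [← sub_sub]

end Weak

/-! ### Matrices -/

lemma clm_ext_single {F : Type*} [NormedAddCommGroup F] [NormedSpace ℂ F] {S T : EllTwo →L[ℂ] F}
    (h : ∀ k : ℕ, S (lp.single 2 k (1 : ℂ)) = T (lp.single 2 k (1 : ℂ))) : S = T := by
  refine lp.ext_continuousLinearMap (by simp) fun k => ?_
  ext
  simpa using h k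

lemma IsMatrixOf.unique {A : Matrix ℕ ℕ ℂ} {S T : EllTwo →L[ℂ] EllTwo} (hS : IsMatrixOf A S)
    (hT : IsMatrixOf A T) : S = T :=
  clm_ext_single fun k => lp.ext (funext fun j => (hS j k).trans (hT j k).symm)

lemma IsMatrixOf.sub {A B : Matrix ℕ ℕ ℂ} {S T : EllTwo →L[ℂ] EllTwo} (hS : IsMatrixOf A S)
    (hT : IsMatrixOf B T) : IsMatrixOf (A - B) (S - T) := fun j k => by
  simp [hS j k, hT j k]

/-- The matrix of a bounded operator on `ℓ²`. -/
def toMatrix (T : EllTwo →L[ℂ] EllTwo) : Matrix ℕ ℕ ℂ :=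
  Matrix.of fun j k => (T (lp.single 2 k (1 : ℂ)) : ℕ → ℂ) j

lemma isMatrixOf_toMatrix (T : EllTwo →L[ℂ] EllTwo) : IsMatrixOf (toMatrix T) T :=
  fun _ _ => rfl

lemma rankOne_single_apply (x y : EllTwo) (j k : ℕ) :
    (InnerProductSpace.rankOne ℂ x y (lp.single 2 k (1 : ℂ)) : ℕ → ℂ) j =
      x j * (starRingEnd ℂ) (y k) := by
  rw [InnerProductSpace.rankOne_apply, lp.inner_single_right, lp.coeFn_smul, Pi.smul_apply,
    smul_eq_mul, mul_comm]
  simp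

/-- `A` is a sum of rank one matrices `xᵢ ⊗ yᵢ` with `∑ (‖xᵢ‖ ‖yᵢ‖) ^ s ≤ M`. -/
def AtomicBound (s M : ℝ) (A : Matrix ℕ ℕ ℂ) : Prop :=
  ∃ (ι : Type) (x y : ι → EllTwo), Summable (fun i => (‖x i‖ * ‖y i‖) ^ s) ∧
    ∑' i, (‖x i‖ * ‖y i‖) ^ s ≤ M ∧
    ∀ j k, HasSum (fun i => x i j * (starRingEnd ℂ) (y i k)) (A j k)

lemma AtomicBound.mono {s M N : ℝ} {A : Matrix ℕ ℕ ℂ} (h : AtomicBound s M A) (hMN : M ≤ N) :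
    AtomicBound s N A := by
  obtain ⟨ι, x, y, h1, h2, h3⟩ := h
  exact ⟨ι, x, y, h1, h2.trans hMN, h3⟩

lemma AtomicBound.zero (s : ℝ) : AtomicBound s 0 0 :=
  ⟨Empty, fun i => i.elim, fun i => i.elim, by simp, by simp,
    fun j k => by simp⟩

lemma AtomicBound.add {s M N : ℝ} {A B : Matrix ℕ ℕ ℂ} (hA : AtomicBound s M A)
    (hB : AtomicBound s N B) : AtomicBound s (M + N) (A + B) := by
  obtain ⟨ι, x, y, h1, h2, h3⟩ := hA
  obtain ⟨κ, u, v, k1, k2, k3⟩ := hB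
  have hs : HasSum (fun i : ι ⊕ κ => (‖Sum.elim x u i‖ * ‖Sum.elim y v i‖) ^ s)
      (∑' i, (‖x i‖ * ‖y i‖) ^ s + ∑' i, (‖u i‖ * ‖v i‖) ^ s) :=
    HasSum.sum (f := fun i : ι ⊕ κ => (‖Sum.elim x u i‖ * ‖Sum.elim y v i‖) ^ s)
      h1.hasSum k1.hasSum
  refine ⟨ι ⊕ κ, Sum.elim x u, Sum.elim y v, hs.summable, ?_, fun j k => ?_⟩
  · rw [hs.tsum_eq]
    exact add_le_add h2 k2
  · exact HasSum.sum (f := fun i : ι ⊕ κ => Sum.elim x u i j * (starRingEnd ℂ) (Sum.elim y v i k))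
      (h3 j k) (k3 j k)

lemma AtomicBound.sum {ι : Type*} {s : ℝ} {M : ι → ℝ} {A : ι → Matrix ℕ ℕ ℂ} (F : Finset ι)
    (h : ∀ i ∈ F, AtomicBound s (M i) (A i)) : AtomicBound s (∑ i ∈ F, M i) (∑ i ∈ F, A i) := by
  classical
  induction F using Finset.induction_on with
  | empty => simpa using AtomicBound.zero s
  | insert a F ha ih =>
    rw [Finset.sum_insert ha, Finset.sum_insert ha]
    exact (h a (by simp)).add (ih fun i hi => h i (by simp [hi]))

/-- A matrix with an atomic decomposition of exponent `s` belongs to weak `S_s`. -/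
lemma AtomicBound.singularValue_le {s M : ℝ} (hs : 0 < s) (hs1 : s ≤ 1) {A : Matrix ℕ ℕ ℂ}
    (hA : AtomicBound s M A) {T : EllTwo →L[ℂ] EllTwo} (hT : IsMatrixOf A T) {n : ℕ} {l : ℝ}
    (hl : 0 < l) (hM : M ≤ n * l ^ s) : singularValue T (3 * n) ≤ l := by
  obtain ⟨ι, x, y, h1, h2, h3⟩ := hA
  -- As `s ≤ 1`, the atoms are absolutely summable in operator norm. Their sum has matrix `A`, hence
  -- is `T`.
  have h4 := (summable_and_tsum_le_of_rpow hs hs1 (fun i => by positivity) h1 le_rfl).1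
  have h5 : Summable fun i => InnerProductSpace.rankOne ℂ (x i) (y i) :=
    Summable.of_norm (by simpa using h4)
  have h6 : IsMatrixOf A (∑' i, InnerProductSpace.rankOne ℂ (x i) (y i)) := fun j k => by
    have h7 := (h5.hasSum.mapL
      (ContinuousLinearMap.apply ℂ EllTwo (lp.single 2 k (1 : ℂ) : EllTwo))).mapL
        (lp.evalCLM ℂ (fun _ : ℕ => ℂ) 2 j)
    exact h7.unique (hasSum_of_forall_eq (fun i => rankOne_single_apply (x i) (y i) j k) (h3 j k))
  have h8 := h5.hasSum
  rw [h6.unique hT] at h8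
  obtain ⟨R, hR, hRl⟩ := exists_rank_le_norm_sub_le_of_rpow hs hs1 h1 h8 hl (h2.trans hM)
  exact (singularValue_le_norm_sub hR).trans hRl

/-! ### Vectors of `ℓ²` and operators given by matrices -/

lemma hasSum_norm_sq (x : EllTwo) : HasSum (fun j => ‖x j‖ ^ 2) (‖x‖ ^ 2) := by
  have := lp.hasSum_norm (p := 2) (by simp) x
  simpa using this

lemma sum_norm_sq_le (x : EllTwo) (F : Finset ℕ) : ∑ j ∈ F, ‖x j‖ ^ 2 ≤ ‖x‖ ^ 2 :=
  sum_le_hasSum F (fun _ _ => by positivity) (hasSum_norm_sq x)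

lemma exists_ellTwo_of_sum_sq_le {f : ℕ → ℂ} {C : ℝ} (hC : 0 ≤ C)
    (h : ∀ F : Finset ℕ, ∑ j ∈ F, ‖f j‖ ^ 2 ≤ C ^ 2) :
    ∃ x : EllTwo, (∀ j, x j = f j) ∧ ‖x‖ ≤ C := by
  have hf : Memℓp f 2 := memℓp_gen' (C := C ^ 2) (by simpa using h)
  refine ⟨⟨f, hf⟩, fun j => rfl, ?_⟩
  exact lp.norm_le_of_forall_sum_le (by simp) hC (by simpa using h)

lemma exists_ellTwo_truncation (F : Finset ℕ) (f : ℕ → ℂ) :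
    ∃ x : EllTwo, (∀ j ∈ F, x j = f j) ∧ ‖x‖ ^ 2 = ∑ j ∈ F, ‖f j‖ ^ 2 ∧
      x = ∑ j ∈ F, f j • (lp.single 2 j (1 : ℂ) : EllTwo) := by
  refine ⟨∑ j ∈ F, lp.single 2 j (f j), fun j hj => ?_, ?_, ?_⟩
  · rw [lp.coeFn_sum, Finset.sum_apply, Finset.sum_eq_single j]
    · simp
    · intro k _ hk
      exact lp.single_apply_ne 2 k _ hk.symm
    · exact fun h => absurd hj h
  · have := lp.norm_sum_single (E := fun _ : ℕ => ℂ) (p := 2) (by simp) f F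
    simpa using this
  · refine Finset.sum_congr rfl fun j _ => ?_
    rw [← lp.single_smul, smul_eq_mul, mul_one]

lemma norm_bilinear_le {B : Matrix ℕ ℕ ℂ} {T : EllTwo →L[ℂ] EllTwo} (hT : IsMatrixOf B T)
    (F : Finset ℕ) (a b : ℕ → ℂ) {α β : ℝ} (hα : 0 ≤ α) (hβ : 0 ≤ β)
    (ha : ∑ k ∈ F, ‖a k‖ ^ 2 ≤ α ^ 2) (hb : ∑ k ∈ F, ‖b k‖ ^ 2 ≤ β ^ 2) :
    ‖∑ j ∈ F, ∑ k ∈ F, B j k * (b j * a k)‖ ≤ ‖T‖ * (β * α) := by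
  obtain ⟨x, -, hx2, hx3⟩ := exists_ellTwo_truncation F a
  obtain ⟨y, -, hy2, hy3⟩ := exists_ellTwo_truncation F fun j => (starRingEnd ℂ) (b j)
  have hxa : ‖x‖ ≤ α := le_of_sq_le_sq (hx2.trans_le ha) hα
  have hyb : ‖y‖ ≤ β := le_of_sq_le_sq (hy2.trans_le (by simpa using hb)) hβ
  have key : ⟪y, T x⟫_ℂ = ∑ j ∈ F, ∑ k ∈ F, B j k * (b j * a k) := by
    rw [hx3, hy3, map_sum, sum_inner]
    refine Finset.sum_congr rfl fun j _ => ?_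
    rw [inner_sum]
    refine Finset.sum_congr rfl fun k _ => ?_
    rw [map_smul, inner_smul_left, inner_smul_right, lp.inner_single_left, hT j k]
    simp
    ring
  rw [← key]
  calc ‖⟪y, T x⟫_ℂ‖ ≤ ‖y‖ * ‖T x‖ := norm_inner_le_norm _ _
    _ ≤ β * (‖T‖ * α) := by
      gcongr
      exact T.le_of_opNorm_le_of_le le_rfl hxa
    _ = _ := by ring

/-- Uniform bounds on finite sections, tested by duality, bound the images of truncated vectors.
Square summable rows then allow passage to the limit. -/
lemma exists_isMatrixOf_of_bilinear_le {M : Matrix ℕ ℕ ℂ} {K : ℝ} (hK : 0 ≤ K)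
    (h : ∀ (F : Finset ℕ) (a b : ℕ → ℂ) (α β : ℝ), 0 ≤ α → 0 ≤ β →
      ∑ k ∈ F, ‖a k‖ ^ 2 ≤ α ^ 2 → ∑ k ∈ F, ‖b k‖ ^ 2 ≤ β ^ 2 →
      ‖∑ j ∈ F, ∑ k ∈ F, M j k * (b j * a k)‖ ≤ K * (β * α)) :
    ∃ T : EllTwo →L[ℂ] EllTwo, IsMatrixOf M T ∧ ‖T‖ ≤ K := by
  classical
  have hsq : ∀ (F : Finset ℕ) (a : ℕ → ℂ) (α : ℝ), 0 ≤ α → ∑ k ∈ F, ‖a k‖ ^ 2 ≤ α ^ 2 →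
      ∑ j ∈ F, ‖∑ k ∈ F, M j k * a k‖ ^ 2 ≤ (K * α) ^ 2 := by
    intro F a α hα ha
    set S := ∑ j ∈ F, ‖∑ k ∈ F, M j k * a k‖ ^ 2 with hS
    have hS0 : 0 ≤ S := Finset.sum_nonneg fun _ _ => by positivity
    have h1 := h F a (fun j => (starRingEnd ℂ) (∑ k ∈ F, M j k * a k)) α (√S) hα
      (Real.sqrt_nonneg _) ha (by simp only [RCLike.norm_conj]; rw [Real.sq_sqrt hS0])
    have h2 : ∑ j ∈ F, ∑ k ∈ F, M j k * ((starRingEnd ℂ) (∑ k ∈ F, M j k * a k) * a k) =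
        (S : ℂ) := by
      rw [hS, Complex.ofReal_sum]
      refine Finset.sum_congr rfl fun j _ => ?_
      rw [Complex.ofReal_pow, ← Complex.mul_conj', Finset.sum_mul]
      refine Finset.sum_congr rfl fun k _ => by ring
    rw [h2, Complex.norm_real, Real.norm_of_nonneg hS0] at h1
    have h3 : √S * √S ≤ (K * α) * √S := by
      rw [Real.mul_self_sqrt hS0]; linarith
    have h4 : √S ≤ K * α := by
      rcases (Real.sqrt_nonneg S).eq_or_lt with h0 | h0
      · rw [← h0]; positivity
      · exact le_of_mul_le_mul_right h3 h0
    calc S = √S ^ 2 := (Real.sq_sqrt hS0).symm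
      _ ≤ (K * α) ^ 2 := by gcongr
  have hrow : ∀ j, Summable fun k => ‖M j k‖ ^ 2 := by
    intro j
    refine summable_of_sum_le (c := K ^ 2) (fun _ => by positivity) fun F => ?_
    have hF : F ⊆ insert j F := Finset.subset_insert _ _
    refine (Finset.sum_le_sum_of_subset_of_nonneg hF fun _ _ _ => by positivity).trans ?_
    set F' := insert j F
    set S := ∑ k ∈ F', ‖M j k‖ ^ 2 with hS
    have hS0 : 0 ≤ S := Finset.sum_nonneg fun _ _ => by positivity
    -- Testing with `b = δ_j` and `a` the conjugate of the j-th row isolates the squared norm of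
    -- that row; this is why `j` was inserted in `F'`.
    have h1 := h F' (fun k => (starRingEnd ℂ) (M j k)) (fun i => if i = j then 1 else 0) (√S) 1
      (Real.sqrt_nonneg _) zero_le_one (by simp only [RCLike.norm_conj]; rw [Real.sq_sqrt hS0])
      (by
        rw [Finset.sum_eq_single j] <;> simp +contextual [F'])
    rw [Finset.sum_eq_single j (by
      intro i _ hi
      simp [hi]) (by simp [F'])] at h1
    have h2 : ∑ k ∈ F', M j k * ((if j = j then (1 : ℂ) else 0) * (starRingEnd ℂ) (M j k)) =
        (S : ℂ) := by
      rw [hS, Complex.ofReal_sum]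
      refine Finset.sum_congr rfl fun k _ => ?_
      rw [if_pos rfl, one_mul, Complex.mul_conj', Complex.ofReal_pow]
    rw [h2, Complex.norm_real, Real.norm_of_nonneg hS0, one_mul] at h1
    have h4 : √S ≤ K := by
      rcases (Real.sqrt_nonneg S).eq_or_lt with h0 | h0
      · rw [← h0]; exact hK
      · refine le_of_mul_le_mul_right ?_ h0
        rwa [Real.mul_self_sqrt hS0]
    calc S = √S ^ 2 := (Real.sq_sqrt hS0).symm
      _ ≤ K ^ 2 := by gcongr
  have hsum : ∀ (x : EllTwo) j, Summable fun k => M j k * x k := by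
    intro x j
    refine Summable.of_norm_bounded (((hrow j).add (hasSum_norm_sq x).summable)) fun k => ?_
    rw [norm_mul]
    nlinarith [sq_nonneg (‖M j k‖ - ‖x k‖), sq_nonneg ‖M j k‖, sq_nonneg ‖x k‖]
  have hex : ∀ x : EllTwo, ∃ y : EllTwo, (∀ j, y j = ∑' k, M j k * x k) ∧ ‖y‖ ≤ K * ‖x‖ := by
    intro x
    refine exists_ellTwo_of_sum_sq_le (by positivity) fun G => ?_
    have hlim : Filter.Tendsto (fun F : Finset ℕ => ∑ j ∈ G, ‖∑ k ∈ F, M j k * x k‖ ^ 2)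
        Filter.atTop (nhds (∑ j ∈ G, ‖∑' k, M j k * x k‖ ^ 2)) :=
      tendsto_finsetSum _ fun j _ => ((hsum x j).hasSum.norm).pow 2
    refine le_of_tendsto hlim ?_
    filter_upwards [Filter.eventually_ge_atTop G] with F hF
    exact (Finset.sum_le_sum_of_subset_of_nonneg hF fun _ _ _ => by positivity).trans
      (hsq F x ‖x‖ (norm_nonneg _) (sum_norm_sq_le x F))
  choose T hT hTn using hex
  let L : EllTwo →ₗ[ℂ] EllTwo :=
    { toFun := T
      map_add' := fun x y => lp.ext <| funext fun j => by
        rw [lp.coeFn_add, Pi.add_apply, hT, hT, hT, ← (hsum x j).tsum_add (hsum y j)]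
        exact tsum_congr fun k => by rw [lp.coeFn_add, Pi.add_apply, mul_add]
      map_smul' := fun c x => lp.ext <| funext fun j => by
        rw [RingHom.id_apply, lp.coeFn_smul, Pi.smul_apply, hT, hT, smul_eq_mul, ← tsum_mul_left]
        exact tsum_congr fun k => by rw [lp.coeFn_smul, Pi.smul_apply, smul_eq_mul]; ring }
  refine ⟨L.mkContinuous K hTn, fun j k => ?_, L.mkContinuous_norm_le hK hTn⟩
  change (T _ : ℕ → ℂ) j = _
  rw [hT, tsum_eq_single k]
  · simp
  · intro i hi
    rw [lp.single_apply_ne 2 k _ hi, mul_zero]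

/-! ### Atomic multipliers -/

/-- The entrywise product of `A` with any rank one matrix `x ⊗ y` has an atomic decomposition of
exponent `s`, with a uniform bound. -/
def AtomicMultiplier (s C : ℝ) (A : Matrix ℕ ℕ ℂ) : Prop :=
  ∀ x y : EllTwo, AtomicBound s (C * (‖x‖ * ‖y‖) ^ s)
    (Matrix.of fun j k => A j k * (x j * (starRingEnd ℂ) (y k)))

/-- Pairing `A ⊙ B` with a rank one matrix is pairing `B` with `A ⊙ (x ⊗ y)`. The latter is a sum of
atoms, absolutely summable by the embedding of `ℓ^s` in `ℓ^1`, and each atom pairs with `B` at cost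
`‖T‖`. -/
lemma AtomicMultiplier.exists_norm_le {s C : ℝ} (hs : 0 < s) (hs1 : s ≤ 1) (hC : 0 ≤ C)
    {A : Matrix ℕ ℕ ℂ} (hA : AtomicMultiplier s C A) {B : Matrix ℕ ℕ ℂ}
    {T : EllTwo →L[ℂ] EllTwo} (hT : IsMatrixOf B T) :
    ∃ T' : EllTwo →L[ℂ] EllTwo, IsMatrixOf (A ⊙ B) T' ∧ ‖T'‖ ≤ C ^ (1 / s) * ‖T‖ := by
  refine exists_isMatrixOf_of_bilinear_le (by positivity) fun F a b α β hα hβ ha hb => ?_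
  obtain ⟨x, hx1, hx2, -⟩ := exists_ellTwo_truncation F b
  obtain ⟨y, hy1, hy2, -⟩ := exists_ellTwo_truncation F fun j => (starRingEnd ℂ) (a j)
  have hxb : ‖x‖ ≤ β := le_of_sq_le_sq (hx2.trans_le hb) hβ
  have hya : ‖y‖ ≤ α := le_of_sq_le_sq (hy2.trans_le (by simpa using ha)) hα
  obtain ⟨ι, u, v, h1, h2, h3⟩ := hA x y
  obtain ⟨h4, h5⟩ := summable_and_tsum_le_of_rpow hs hs1 (fun i => by positivity) h1 h2
  have hsum : HasSum (fun i => ∑ j ∈ F, ∑ k ∈ F, B j k * (u i j * (starRingEnd ℂ) (v i k)))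
      (∑ j ∈ F, ∑ k ∈ F, (A ⊙ B) j k * (b j * a k)) := by
    refine hasSum_sum fun j hj => hasSum_sum fun k hk => ?_
    have := (h3 j k).mul_left (B j k)
    rw [Matrix.of_apply, hx1 j hj, hy1 k hk, Complex.conj_conj] at this
    rwa [Matrix.hadamard_apply, mul_comm (A j k), mul_assoc]
  rw [← hsum.tsum_eq]
  have hle : ∀ i, ‖∑ j ∈ F, ∑ k ∈ F, B j k * (u i j * (starRingEnd ℂ) (v i k))‖ ≤
      ‖T‖ * (‖u i‖ * ‖v i‖) := fun i =>
    norm_bilinear_le hT F (fun k => (starRingEnd ℂ) (v i k)) (u i) (norm_nonneg _) (norm_nonneg _)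
      (by simpa using sum_norm_sq_le (v i) F) (sum_norm_sq_le (u i) F)
  refine (tsum_of_norm_bounded (h4.mul_left ‖T‖).hasSum hle).trans ?_
  rw [tsum_mul_left]
  calc ‖T‖ * ∑' i, ‖u i‖ * ‖v i‖ ≤ ‖T‖ * (C * (‖x‖ * ‖y‖) ^ s) ^ (1 / s) := by gcongr
    _ = ‖T‖ * (C ^ (1 / s) * (‖x‖ * ‖y‖)) := by
      rw [Real.mul_rpow hC (by positivity), ← Real.rpow_mul (by positivity),
        mul_one_div_cancel hs.ne', Real.rpow_one]
    _ ≤ ‖T‖ * (C ^ (1 / s) * (β * α)) := by gcongr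
    _ = _ := by ring

/-- With `bᵢ` an orthonormal basis of the range, `R = ∑ bᵢ ⊗ R* bᵢ`. Every atom is bounded by `‖R‖`,
so the `ℓ^s` cost is at most rank times `‖R‖ ^ s`. -/
lemma exists_eq_sum_rankOne {E : Type*} [NormedAddCommGroup E] [InnerProductSpace ℂ E]
    [CompleteSpace E] {R : E →L[ℂ] E} {r : ℕ} (hR : (R : E →ₗ[ℂ] E).rank ≤ r) :
    ∃ d ≤ r, ∃ x y : Fin d → E, (∀ i, ‖x i‖ ≤ 1) ∧ (∀ i, ‖y i‖ ≤ ‖R‖) ∧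
      R = ∑ i, InnerProductSpace.rankOne ℂ (x i) (y i) := by
  set V := LinearMap.range (R : E →ₗ[ℂ] E) with hV
  have hfin : FiniteDimensional ℂ V :=
    Module.rank_lt_aleph0_iff.1 (hR.trans_lt (Cardinal.natCast_lt_aleph0))
  have hd : Module.finrank ℂ V ≤ r := by
    have h : (Module.finrank ℂ V : Cardinal) ≤ r := by
      rw [Module.finrank_eq_rank]; exact hR
    exact_mod_cast h
  set b := stdOrthonormalBasis ℂ V with hb
  refine ⟨_, hd, fun i => (b i : E), fun i => ContinuousLinearMap.adjoint R (b i : E),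
    fun i => ?_, fun i => ?_, ?_⟩
  · exact (b.norm_eq_one i).le
  · refine (ContinuousLinearMap.le_opNorm _ _).trans ?_
    rw [LinearIsometryEquiv.norm_map]
    exact (mul_le_mul_of_nonneg_left (b.norm_eq_one i).le (norm_nonneg _)).trans_eq (mul_one _)
  · ext z
    have hz : R z ∈ V := ⟨z, rfl⟩
    have h1 := congrArg (Subtype.val) (b.sum_repr' ⟨R z, hz⟩)
    simp only [Submodule.coe_sum, Submodule.coe_smul, Submodule.coe_inner] at h1
    rw [sum_apply]
    simp only [InnerProductSpace.rankOne_apply, ContinuousLinearMap.adjoint_inner_left]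
    exact h1.symm

lemma AtomicMultiplier.atomicBound_of_rank_le {s C : ℝ} (hs : 0 < s) (hC : 0 ≤ C)
    {A : Matrix ℕ ℕ ℂ} (hA : AtomicMultiplier s C A) {R : EllTwo →L[ℂ] EllTwo} {r : ℕ}
    (hR : (R : EllTwo →ₗ[ℂ] EllTwo).rank ≤ r) {t : ℝ} (ht : ‖R‖ ≤ t) :
    AtomicBound s (r * (C * t ^ s)) (A ⊙ toMatrix R) := by
  obtain ⟨d, hd, x, y, hx, hy, hsum⟩ := exists_eq_sum_rankOne hR
  have ht0 : 0 ≤ t := (norm_nonneg _).trans ht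
  have hb : ∀ i, AtomicBound s (C * t ^ s)
      (Matrix.of fun j k => A j k * (x i j * (starRingEnd ℂ) (y i k))) := fun i => by
    refine (hA (x i) (y i)).mono ?_
    gcongr
    calc ‖x i‖ * ‖y i‖ ≤ 1 * t := by
          gcongr
          exacts [hx i, (hy i).trans ht]
      _ = t := one_mul t
  have := AtomicBound.sum Finset.univ fun i (_ : i ∈ Finset.univ) => hb i
  rw [Finset.sum_const, Finset.card_univ, Fintype.card_fin, nsmul_eq_mul] at this
  have h2 : A ⊙ toMatrix R =
      ∑ i, Matrix.of fun j k => A j k * (x i j * (starRingEnd ℂ) (y i k)) := by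
    ext j k
    rw [Matrix.hadamard_apply, Matrix.sum_apply]
    simp only [Matrix.of_apply, ← Finset.mul_sum, toMatrix]
    congr 1
    rw [hsum, sum_apply, lp.coeFn_sum, Finset.sum_apply]
    exact Finset.sum_congr rfl fun i _ => rankOne_single_apply _ _ _ _
  rw [h2]
  refine this.mono ?_
  gcongr

/-! ### Interpolation: atomic multipliers of exponent `s` act on `S_p` for `p > s` -/

/-- A dyadic form of Hardy's inequality. -/
lemma summable_dyadic_hardy {b : ℕ → ℝ} (hb : ∀ k, 0 ≤ b k) {r : ℝ} (hr : 1 < r)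
    (h : Summable fun k : ℕ => (2 : ℝ) ^ k * b k ^ r) :
    Summable fun K : ℕ =>
      (2 : ℝ) ^ K * (∑ k ∈ Finset.range (K + 1), (1 / 2 : ℝ) ^ (K - k) * b k) ^ r := by
  -- The kernel `(1/2) ^ m` is split as `σ ^ m · σ ^ m`. One factor is the weight in the power mean
  -- inequality; the other, raised to the power `r`, leaves `2 ^ m σ ^ m σ ^ (m r) = η ^ m`, a
  -- summable convolution kernel because `r > 1`.
  set σ : ℝ := √(1 / 2) with hσ
  have hσ0 : 0 < σ := by rw [hσ]; positivity
  have hσ2 : σ * σ = 1 / 2 := by rw [hσ]; exact Real.mul_self_sqrt (by norm_num)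
  have hσ1 : σ < 1 := by nlinarith
  set η : ℝ := σ ^ (r - 1) with hη
  have hη0 : 0 < η := by positivity
  have hη1 : η < 1 := Real.rpow_lt_one hσ0.le hσ1 (by linarith)
  set W : ℝ := ∑' m : ℕ, σ ^ m with hW
  have hWs : Summable fun m : ℕ => σ ^ m := summable_geometric_of_lt_one hσ0.le hσ1
  have hηs : Summable fun m : ℕ => η ^ m := summable_geometric_of_lt_one hη0.le hη1
  have hconv := summable_sum_mul_range_of_summable_norm' h.norm h hηs.norm hηs
  have hbr : ∀ k, 0 ≤ b k ^ r := fun k => Real.rpow_nonneg (hb k) r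
  have hSn : ∀ K : ℕ, 0 ≤ ∑ k ∈ Finset.range (K + 1), (1 / 2 : ℝ) ^ (K - k) * b k := fun K =>
    Finset.sum_nonneg fun k _ => by have := hb k; positivity
  refine Summable.of_nonneg_of_le (fun K => ?_) (fun K => ?_) (hconv.mul_left (W ^ (r - 1)))
  · have := Real.rpow_nonneg (hSn K) r
    positivity
  have hj := Real.inner_le_weight_mul_Lp_of_nonneg (Finset.range (K + 1)) hr.le
    (fun k => σ ^ (K - k)) (fun k => σ ^ (K - k) * b k) (fun k => by positivity)
    (fun k => by have := hb k; positivity)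
  have hwle : ∑ k ∈ Finset.range (K + 1), σ ^ (K - k) ≤ W := by
    have h1 : ∑ k ∈ Finset.range (K + 1), σ ^ (K - k) = ∑ m ∈ Finset.range (K + 1), σ ^ m := by
      rw [← Finset.sum_range_reflect (fun m => σ ^ m)]
      refine Finset.sum_congr rfl fun k hk => ?_
      congr 1
    rw [h1]
    exact hWs.sum_le_tsum _ fun _ _ => by positivity
  have hterm : ∀ k ∈ Finset.range (K + 1), (2 : ℝ) ^ K * (σ ^ (K - k) * (σ ^ (K - k) * b k) ^ r) =
      2 ^ k * b k ^ r * η ^ (K - k) := by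
    intro k hk
    obtain ⟨m, rfl⟩ := Nat.exists_eq_add_of_le (Finset.mem_range_succ_iff.1 hk)
    rw [Nat.add_sub_cancel_left, Real.mul_rpow (by positivity) (hb k), hη,
      ← Real.rpow_natCast (σ ^ (r - 1)), ← Real.rpow_mul hσ0.le, ← Real.rpow_natCast σ m,
      ← Real.rpow_mul hσ0.le, pow_add]
    have h2 : (2 : ℝ) ^ m = σ ^ (-(2 * m) : ℝ) := by
      have : (2 : ℝ) = σ ^ (-2 : ℝ) := by
        rw [Real.rpow_neg hσ0.le, Real.rpow_ofNat, sq, hσ2]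
        norm_num
      calc (2 : ℝ) ^ m = (σ ^ (-2 : ℝ)) ^ (m : ℝ) := by rw [← this, Real.rpow_natCast]
        _ = σ ^ (-(2 * m) : ℝ) := by
          rw [← Real.rpow_mul hσ0.le]
          congr 1
          ring
    rw [h2]
    have h3 : σ ^ (-(2 * m) : ℝ) * (σ ^ (m : ℝ) * σ ^ ((m : ℝ) * r)) = σ ^ ((r - 1) * m) := by
      rw [← Real.rpow_add hσ0, ← Real.rpow_add hσ0]
      congr 1
      ring
    rw [← h3]
    ring
  set S := ∑ k ∈ Finset.range (K + 1), σ ^ (K - k) * (σ ^ (K - k) * b k) ^ r with hS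
  have hS0 : 0 ≤ S := Finset.sum_nonneg fun k _ => by
    have := hb k
    positivity
  have hwn : 0 ≤ ∑ k ∈ Finset.range (K + 1), σ ^ (K - k) :=
    Finset.sum_nonneg fun k _ => by positivity
  have heq : ∑ k ∈ Finset.range (K + 1), (1 / 2 : ℝ) ^ (K - k) * b k =
      ∑ k ∈ Finset.range (K + 1), σ ^ (K - k) * (σ ^ (K - k) * b k) := by
    refine Finset.sum_congr rfl fun k _ => ?_
    rw [← hσ2, mul_pow]
    ring
  have hmain : (∑ k ∈ Finset.range (K + 1), (1 / 2 : ℝ) ^ (K - k) * b k) ^ r ≤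
      W ^ (r - 1) * S := by
    calc (∑ k ∈ Finset.range (K + 1), (1 / 2 : ℝ) ^ (K - k) * b k) ^ r
        ≤ ((∑ k ∈ Finset.range (K + 1), σ ^ (K - k)) ^ (1 - r⁻¹) * S ^ r⁻¹) ^ r := by
          refine Real.rpow_le_rpow (hSn K) ?_ (by linarith)
          rw [heq]
          exact hj
      _ = (∑ k ∈ Finset.range (K + 1), σ ^ (K - k)) ^ (r - 1) * S := by
          rw [Real.mul_rpow (by positivity) (by positivity), ← Real.rpow_mul hwn,
            ← Real.rpow_mul hS0, inv_mul_cancel₀ (by linarith), Real.rpow_one]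
          congr 2
          field_simp
      _ ≤ W ^ (r - 1) * S := by
          gcongr
  calc (2 : ℝ) ^ K * (∑ k ∈ Finset.range (K + 1), (1 / 2 : ℝ) ^ (K - k) * b k) ^ r
      ≤ 2 ^ K * (W ^ (r - 1) * S) := by gcongr
    _ = W ^ (r - 1) * (2 ^ K * S) := by ring
    _ = _ := by
      rw [hS, Finset.mul_sum, Finset.sum_congr rfl hterm]

lemma toMatrix_add (S T : EllTwo →L[ℂ] EllTwo) : toMatrix (S + T) = toMatrix S + toMatrix T := by
  ext j k
  simp [toMatrix]

lemma IsMatrixOf.toMatrix_eq {A : Matrix ℕ ℕ ℂ} {T : EllTwo →L[ℂ] EllTwo} (h : IsMatrixOf A T) :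
    toMatrix T = A := by
  ext j k
  exact h j k

lemma antitone_singularValue_rpow {p : ℝ} (hp : 0 < p) (S : EllTwo →L[ℂ] EllTwo) ⦃m n : ℕ⦄
    (_ : 0 < m) (hmn : m ≤ n) : singularValue S n ^ p ≤ singularValue S m ^ p :=
  Real.rpow_le_rpow (singularValue_nonneg S n) (singularValue_antitone S hmn) hp.le

lemma singularValue_rpow_nonneg {p : ℝ} (S : EllTwo →L[ℂ] EllTwo) (n : ℕ) :
    0 ≤ singularValue S n ^ p :=
  Real.rpow_nonneg (singularValue_nonneg S n) p

lemma IsSchatten.exists_dyadic_approximation {p : ℝ} (hp : 0 < p) {T : EllTwo →L[ℂ] EllTwo}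
    (hTp : IsSchatten p T) : ∃ (t : ℕ → ℝ) (R : ℕ → EllTwo →L[ℂ] EllTwo), (∀ k, 0 < t k) ∧
      (∀ k, t (k + 1) ≤ t k) ∧ (Summable fun k : ℕ => (2 : ℝ) ^ k * t k ^ p) ∧
      (∀ k, (R k : EllTwo →ₗ[ℂ] EllTwo).rank ≤ (2 ^ k : ℕ)) ∧ ∀ k, ‖T - R k‖ < t k := by
  have hcond := (summable_condensed_iff_of_nonneg (singularValue_rpow_nonneg T) (antitone_singularValue_rpow hp T)).2 hTp
  -- The term `(1/4) ^ k` puts `t k` strictly above the singular value, so that an approximant of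
  -- that quality exists; weighted by `2 ^ k` it stays summable.
  set t : ℕ → ℝ := fun k => (singularValue T (2 ^ k) ^ p + (1 / 4 : ℝ) ^ k) ^ (1 / p) with ht
  have htp : ∀ k, t k ^ p = singularValue T (2 ^ k) ^ p + (1 / 4 : ℝ) ^ k := fun k => by
    have := singularValue_rpow_nonneg (p := p) T (2 ^ k)
    rw [ht]
    dsimp only
    rw [← Real.rpow_mul (by positivity), one_div_mul_cancel hp.ne', Real.rpow_one]
  have ht0 : ∀ k, 0 < t k := fun k => by
    have := singularValue_rpow_nonneg (p := p) T (2 ^ k)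
    rw [ht]
    positivity
  have hlt : ∀ k, singularValue T (2 ^ k) < t k := fun k => by
    rw [← Real.rpow_lt_rpow_iff (singularValue_nonneg _ _) (ht0 k).le hp, htp]
    have : (0 : ℝ) < (1 / 4) ^ k := by positivity
    linarith
  have htanti : ∀ k, t (k + 1) ≤ t k := fun k => by
    rw [← Real.rpow_le_rpow_iff (ht0 _).le (ht0 k).le hp, htp, htp]
    exact add_le_add (antitone_singularValue_rpow hp T (by positivity) (Nat.pow_le_pow_right two_pos k.le_succ))
      (pow_le_pow_of_le_one (by norm_num) (by norm_num) k.le_succ)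
  choose R hRrank hRnorm using fun k => exists_rank_le_norm_sub_lt (hlt k)
  refine ⟨t, R, ht0, htanti, ?_, hRrank, hRnorm⟩
  have h1 : Summable fun k : ℕ => (2 : ℝ) ^ k * singularValue T (2 ^ k) ^ p + (1 / 2 : ℝ) ^ k :=
    hcond.add (summable_geometric_of_lt_one (by norm_num) (by norm_num))
  convert h1 using 2 with k
  rw [htp, mul_add, ← mul_pow]
  norm_num

/-- Telescoping: `R (k + 1) - R k` has rank at most `2 ^ (k + 1) + 2 ^ k = 3 · 2 ^ k` and norm at
most `2 t k`. -/
lemma AtomicMultiplier.atomicBound_of_approximation {s C : ℝ} (hs : 0 < s)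
    (hC : 0 ≤ C) {A : Matrix ℕ ℕ ℂ} (hA : AtomicMultiplier s C A) {T : EllTwo →L[ℂ] EllTwo}
    {t : ℕ → ℝ} {R : ℕ → EllTwo →L[ℂ] EllTwo} (ht0 : ∀ k, 0 < t k)
    (htanti : ∀ k, t (k + 1) ≤ t k)
    (hRrank : ∀ k, (R k : EllTwo →ₗ[ℂ] EllTwo).rank ≤ (2 ^ k : ℕ))
    (hRnorm : ∀ k, ‖T - R k‖ < t k) (K : ℕ) :
    AtomicBound s (C * (‖T‖ + t 0) ^ s +
      3 * C * 2 ^ s * ∑ k ∈ Finset.range K, (2 : ℝ) ^ k * t k ^ s) (A ⊙ toMatrix (R K)) := by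
  induction K with
  | zero =>
    have hR0 : ‖R 0‖ ≤ ‖T‖ + t 0 := by
      have h1 : R 0 = T - (T - R 0) := by abel
      rw [h1]
      exact (norm_sub_le _ _).trans (by gcongr; exact (hRnorm 0).le)
    simpa using hA.atomicBound_of_rank_le hs hC (hRrank 0) hR0
  | succ K ih =>
    have hd : ‖R (K + 1) - R K‖ ≤ 2 * t K := by
      have h1 : R (K + 1) - R K = (T - R K) - (T - R (K + 1)) := by abel
      rw [h1]
      refine (norm_sub_le _ _).trans ?_
      linarith [(hRnorm K).le, (hRnorm (K + 1)).le, htanti K]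
    have h2 := ih.add (hA.atomicBound_of_rank_le hs hC
      (rank_sub_le_add (hRrank (K + 1)) (hRrank K)) hd)
    rw [← Matrix.hadamard_add, ← toMatrix_add, add_sub_cancel] at h2
    refine h2.mono (le_of_eq ?_)
    rw [Finset.sum_range_succ, Real.mul_rpow two_pos.le (ht0 K).le, pow_succ]
    push_cast
    ring

/-- Split `T = R K + (T - R K)`. The image of `R K` is controlled by the weak `S_s` estimate, that
of the remainder in operator norm. Both are `O(u K ^ (1 / s))`, where `u` is a discounted sum of `t
k ^ s`, and Hardy's inequality with exponent `p / s > 1` makes `2 ^ K u K ^ (p / s)` summable. -/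
lemma AtomicMultiplier.isSchurMultiplier {s p C : ℝ} (hs : 0 < s) (hs1 : s ≤ 1) (hsp : s < p)
    (hC : 0 ≤ C) {A : Matrix ℕ ℕ ℂ} (hA : AtomicMultiplier s C A) : IsSchurMultiplier p A := by
  rintro B ⟨T, hTB, hTp⟩
  have hp : 0 < p := hs.trans hsp
  obtain ⟨T', hT', -⟩ := hA.exists_norm_le hs hs1 hC hTB
  refine ⟨T', hT', ?_⟩
  obtain ⟨t, R, ht0, htanti, htp, hRrank, hRnorm⟩ := hTp.exists_dyadic_approximation hp
  have htsum : Summable fun k : ℕ => (2 : ℝ) ^ k * (t k ^ s) ^ (p / s) := by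
    convert htp using 3 with k
    rw [← Real.rpow_mul (ht0 k).le, mul_div_cancel₀ _ hs.ne']
  set u : ℕ → ℝ := fun K => ∑ k ∈ Finset.range (K + 1), (1 / 2 : ℝ) ^ (K - k) * t k ^ s with hu
  have hhardy : Summable fun K : ℕ => (2 : ℝ) ^ K * u K ^ (p / s) :=
    summable_dyadic_hardy (fun k => by have := ht0 k; positivity) ((one_lt_div hs).2 hsp) htsum
  have hut : ∀ K, t K ^ s ≤ u K := fun K => by
    have h1 := Finset.single_le_sum (f := fun k => (1 / 2 : ℝ) ^ (K - k) * t k ^ s)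
      (fun k _ => by have := ht0 k; positivity) (Finset.self_mem_range_succ K)
    simp only [Nat.sub_self, pow_zero, one_mul] at h1
    exact h1
  have hu0 : ∀ K, 0 < u K := fun K => lt_of_lt_of_le (by have := ht0 K; positivity) (hut K)
  have hu2 : ∀ K, (2 : ℝ) ^ K * u K = ∑ k ∈ Finset.range (K + 1), (2 : ℝ) ^ k * t k ^ s := by
    intro K
    rw [hu, Finset.mul_sum]
    refine Finset.sum_congr rfl fun k hk => ?_
    obtain ⟨m, rfl⟩ := Nat.exists_eq_add_of_le (Finset.mem_range_succ_iff.1 hk)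
    rw [Nat.add_sub_cancel_left, pow_add, ← mul_assoc, mul_assoc (2 ^ k), ← mul_pow]
    norm_num
  have hts : ∀ k, 0 ≤ (2 : ℝ) ^ k * t k ^ s := fun k => by have := ht0 k; positivity
  have hatom := hA.atomicBound_of_approximation hs hC ht0 htanti hRrank hRnorm
  -- The first summand absorbs the initial term, since `t 0 ^ s ≤ 2 ^ K u K`; the final `1` only
  -- makes `D` positive.
  set D : ℝ := C * (‖T‖ + t 0) ^ s / t 0 ^ s + 3 * C * 2 ^ s + 1 with hD
  have hD0 : 0 < D := by have := ht0 0; positivity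
  have hDu : ∀ K, C * (‖T‖ + t 0) ^ s + 3 * C * 2 ^ s * ∑ k ∈ Finset.range K, (2 : ℝ) ^ k * t k ^ s
      ≤ D * (2 ^ K * u K) := by
    intro K
    have h0 := ht0 0
    have h1 : t 0 ^ s ≤ 2 ^ K * u K := by
      rw [hu2]
      simpa using Finset.single_le_sum (fun k _ => hts k)
        (Finset.mem_range.2 (Nat.succ_pos K))
    have h2 : ∑ k ∈ Finset.range K, (2 : ℝ) ^ k * t k ^ s ≤ 2 ^ K * u K := by
      rw [hu2]
      exact Finset.sum_le_sum_of_subset_of_nonneg (Finset.range_mono K.le_succ)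
        fun k _ _ => hts k
    have h3 : C * (‖T‖ + t 0) ^ s / t 0 ^ s * t 0 ^ s = C * (‖T‖ + t 0) ^ s :=
      div_mul_cancel₀ _ (by positivity)
    have h4 : 0 ≤ 2 ^ K * u K := by have := hu0 K; positivity
    have h5 := mul_le_mul_of_nonneg_left h1
      (show 0 ≤ C * (‖T‖ + t 0) ^ s / t 0 ^ s by positivity)
    have h6 := mul_le_mul_of_nonneg_left h2 (show 0 ≤ 3 * C * 2 ^ s by positivity)
    rw [h3] at h5
    have h7 : D * (2 ^ K * u K) = C * (‖T‖ + t 0) ^ s / t 0 ^ s * (2 ^ K * u K) +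
        3 * C * 2 ^ s * (2 ^ K * u K) + 2 ^ K * u K := by
      rw [hD]
      ring
    linarith
  set E : ℝ := D ^ (1 / s) + C ^ (1 / s) with hE
  have hE0 : 0 ≤ E := by positivity
  have hsv : ∀ K, singularValue T' (2 ^ (K + 2)) ≤ E * u K ^ (1 / s) := by
    intro K
    have hK := hu0 K
    obtain ⟨T₂, hT₂, hT₂n⟩ := hA.exists_norm_le hs hs1 hC (isMatrixOf_toMatrix (T - R K))
    have hT₁ : IsMatrixOf (A ⊙ toMatrix (R K)) (T' - T₂) := by
      have h1 : A ⊙ toMatrix (R K) = A ⊙ B - A ⊙ toMatrix (T - R K) := by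
        rw [eq_sub_iff_add_eq, ← Matrix.hadamard_add, ← toMatrix_add, add_sub_cancel,
          hTB.toMatrix_eq]
      rw [h1]
      exact hT'.sub hT₂
    -- This `l` satisfies `2 ^ K l ^ s = D 2 ^ K u K`, the atomic bound. The resulting index `3 · 2
    -- ^ K` is below `2 ^ (K + 2)`.
    have h2 := (hatom K).singularValue_le hs hs1 hT₁ (n := 2 ^ K) (l := (D * u K) ^ (1 / s))
      (by positivity) (by
        rw [← Real.rpow_mul (by positivity), one_div_mul_cancel hs.ne', Real.rpow_one]
        refine (hDu K).trans (le_of_eq ?_)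
        push_cast
        ring)
    have h3 : ‖T₂‖ ≤ C ^ (1 / s) * u K ^ (1 / s) := by
      refine hT₂n.trans ?_
      gcongr
      refine (hRnorm K).le.trans ?_
      calc t K = (t K ^ s) ^ (1 / s) := by
            rw [← Real.rpow_mul (ht0 K).le, mul_one_div_cancel hs.ne', Real.rpow_one]
        _ ≤ u K ^ (1 / s) := by
          have := ht0 K
          gcongr
          exact hut K
    have h4 := singularValue_add_le_add_norm (T' - T₂) T₂ (3 * 2 ^ K)
    rw [sub_add_cancel] at h4
    have h5 : singularValue T' (2 ^ (K + 2)) ≤ singularValue T' (3 * 2 ^ K) :=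
      singularValue_antitone T' (by rw [pow_add]; omega)
    rw [Real.mul_rpow hD0.le hK.le] at h2
    rw [hE, add_mul]
    linarith
  have hfin : Summable fun K : ℕ => (2 : ℝ) ^ (K + 2) * singularValue T' (2 ^ (K + 2)) ^ p := by
    refine Summable.of_nonneg_of_le (fun K => ?_) (fun K => ?_) (hhardy.mul_left (4 * E ^ p))
    · have := singularValue_rpow_nonneg (p := p) T' (2 ^ (K + 2))
      positivity
    · have hK := hu0 K
      have h1 : singularValue T' (2 ^ (K + 2)) ^ p ≤ E ^ p * u K ^ (p / s) := by
        refine (Real.rpow_le_rpow (singularValue_nonneg _ _) (hsv K) hp.le).trans (le_of_eq ?_)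
        rw [Real.mul_rpow hE0 (by positivity), ← Real.rpow_mul hK.le, one_div_mul_eq_div]
      calc (2 : ℝ) ^ (K + 2) * singularValue T' (2 ^ (K + 2)) ^ p
          ≤ 2 ^ (K + 2) * (E ^ p * u K ^ (p / s)) := by gcongr
        _ = _ := by ring
  exact (summable_condensed_iff_of_nonneg (singularValue_rpow_nonneg T') (antitone_singularValue_rpow hp T')).1 ((summable_nat_add_iff 2).1 hfin)

/-! ### The symbol -/

/-- The scales `2 ^ n ^ 2`. -/
def scale (n : ℕ) : ℝ := 2 ^ n ^ 2

/-- The coefficients of the Poisson-like kernel at scale `n`. -/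
def damp (n j : ℕ) : ℝ := Real.exp (-(j / scale n))

/-- A bump concentrated on indices comparable with `scale n`. -/
def bump (n j : ℕ) : ℝ := damp n j - damp n j ^ 2

/-- A sequence of points of the unit circle converging to `1`. -/
def node (n : ℕ) : ℂ := ⟨√(1 - ((1 / 2) ^ n) ^ 2), (1 / 2) ^ n⟩

/-- The amplitudes of the bumps. -/
def amplitude (n : ℕ) : ℝ := 1 / (n + 1)

/-- The Taylor coefficients of the symbol. -/
def symbolCoeff (j : ℕ) : ℂ := ∑' n, ((amplitude n * bump n j : ℝ) : ℂ) * node n ^ j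

lemma scale_pos (n : ℕ) : 0 < scale n := by unfold scale; positivity

lemma damp_pos (n j : ℕ) : 0 < damp n j := Real.exp_pos _

lemma damp_le_one (n j : ℕ) : damp n j ≤ 1 := by
  have := scale_pos n
  rw [damp, Real.exp_le_one_iff, neg_nonpos]
  positivity

lemma damp_add (n j k : ℕ) : damp n (j + k) = damp n j * damp n k := by
  rw [damp, damp, damp, ← Real.exp_add]
  congr 1
  push_cast
  ring

lemma bump_nonneg (n j : ℕ) : 0 ≤ bump n j := by
  have h1 := damp_le_one n j
  have h2 := damp_pos n j
  rw [bump]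
  nlinarith

/-- The form `d e - d² e² = (d - d²) e + d² (e - e²)` keeps a bump in one variable in each term,
which provides the orthogonality-type gain in `n`. -/
lemma bump_add (n j k : ℕ) :
    bump n (j + k) = bump n j * damp n k + damp n j ^ 2 * bump n k := by
  rw [bump, bump, bump, damp_add]
  ring

lemma two_mul_scale_le (n : ℕ) : 2 * scale n ≤ scale (n + 1) := by
  rw [scale, scale, ← pow_succ']
  refine pow_le_pow_right₀ one_le_two ?_
  have : (n + 1) ^ 2 = n ^ 2 + 1 + 2 * n := by ring
  omega

/-- This makes the sum of the bumps telescope: `damp n + bump (n + 1) ≤ damp (n + 1)`. -/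
lemma damp_le_damp_succ_sq (n j : ℕ) : damp n j ≤ damp (n + 1) j ^ 2 := by
  have h1 := scale_pos n
  have h2 := scale_pos (n + 1)
  rw [damp, damp, ← Real.exp_nat_mul, Real.exp_le_exp]
  have h3 : (2 : ℕ) * ((j : ℝ) / scale (n + 1)) ≤ j / scale n := by
    rw [← mul_div_assoc, div_le_div_iff₀ h2 h1]
    push_cast
    nlinarith [two_mul_scale_le n, (Nat.cast_nonneg j : (0 : ℝ) ≤ j)]
  linarith

lemma sum_bump_le_damp (M j : ℕ) : ∑ n ∈ Finset.range (M + 1), bump n j ≤ damp M j := by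
  induction M with
  | zero =>
    rw [Finset.sum_range_one, bump]
    nlinarith [damp_pos 0 j]
  | succ M ih =>
    rw [Finset.sum_range_succ, bump]
    linarith [damp_le_damp_succ_sq M j]

lemma sum_bump_le_one (F : Finset ℕ) (j : ℕ) : ∑ n ∈ F, bump n j ≤ 1 := by
  obtain ⟨M, hM⟩ := F.exists_nat_subset_range
  calc ∑ n ∈ F, bump n j ≤ ∑ n ∈ Finset.range (M + 1), bump n j :=
        Finset.sum_le_sum_of_subset_of_nonneg (hM.trans (Finset.range_mono M.le_succ))
          fun n _ _ => bump_nonneg n j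
    _ ≤ 1 := (sum_bump_le_damp M j).trans (damp_le_one M j)

lemma summable_bump (j : ℕ) : Summable fun n => bump n j :=
  summable_of_sum_le (fun n => bump_nonneg n j) fun F => sum_bump_le_one F j

lemma bump_le_one (n j : ℕ) : bump n j ≤ 1 := by
  simpa using sum_bump_le_one {n} j

lemma norm_node (n : ℕ) : ‖node n‖ = 1 := by
  have h1 : ((1 / 2 : ℝ) ^ n) ^ 2 ≤ 1 :=
    pow_le_one₀ (by positivity) (pow_le_one₀ (by norm_num) (by norm_num))
  rw [← sq_eq_sq₀ (norm_nonneg _) zero_le_one, Complex.sq_norm, Complex.normSq_mk, node,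
    Real.mul_self_sqrt (by linarith)]
  ring

lemma amplitude_pos (n : ℕ) : 0 < amplitude n := by unfold amplitude; positivity

lemma amplitude_le_one (n : ℕ) : amplitude n ≤ 1 := by
  rw [amplitude, div_le_one (by positivity)]
  linarith [(Nat.cast_nonneg n : (0 : ℝ) ≤ n)]

lemma norm_symbolCoeff_term_le (n j : ℕ) :
    ‖((amplitude n * bump n j : ℝ) : ℂ) * node n ^ j‖ ≤ amplitude n * bump n j := by
  have h1 := amplitude_pos n
  have h2 := bump_nonneg n j
  rw [norm_mul, norm_pow, norm_node, one_pow, mul_one, Complex.norm_real,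
    Real.norm_of_nonneg (by positivity)]

lemma amplitude_mul_bump_le (n j : ℕ) : amplitude n * bump n j ≤ bump n j :=
  mul_le_of_le_one_left (bump_nonneg n j) (amplitude_le_one n)

lemma hasSum_symbolCoeff (j : ℕ) :
    HasSum (fun n => ((amplitude n * bump n j : ℝ) : ℂ) * node n ^ j) (symbolCoeff j) :=
  (Summable.of_norm_bounded (summable_bump j) fun n =>
    (norm_symbolCoeff_term_le n j).trans (amplitude_mul_bump_le n j)).hasSum

lemma norm_symbolCoeff_le_one (j : ℕ) : ‖symbolCoeff j‖ ≤ 1 := by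
  refine (tsum_of_norm_bounded (summable_bump j).hasSum fun n =>
    (norm_symbolCoeff_term_le n j).trans (amplitude_mul_bump_le n j)).trans ?_
  exact (summable_bump j).tsum_le_of_sum_le fun F => sum_bump_le_one F j

/-! ### The Hankel matrix of the symbol is an atomic multiplier -/

/-- Hölder with `1/s = 1/p + 1/2`. The amplitudes `1 / (n + 1)` lie in `ℓ^p` because `p = 2 s / (2 -
s) > 1`, which is exactly `s > 2/3`. -/
lemma exists_norm_mul_rpow_bound {s : ℝ} (hs : 2 / 3 < s) (hs1 : s ≤ 1) :
    ∃ W : ℝ, 0 ≤ W ∧ ∀ (z v : ℕ → ℝ) (X Y : ℝ), (∀ n, 0 ≤ z n) → (∀ n, 0 ≤ v n) → 0 ≤ X →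
      (Summable fun n => z n ^ 2) → ∑' n, z n ^ 2 ≤ X ^ 2 → (∀ n, v n ≤ Y) →
      Summable (fun n => (amplitude n * z n * v n) ^ s) ∧
        ∑' n, (amplitude n * z n * v n) ^ s ≤ W * (X * Y) ^ s := by
  set p : ℝ := 2 * s / (2 - s) with hp
  have hs0 : 0 < s := by linarith
  have hp1 : 1 < p := by
    rw [hp, one_lt_div (by linarith)]
    linarith
  have htri : p.HolderTriple 2 s := by
    refine ⟨?_, by linarith, by norm_num⟩
    rw [hp]
    have : 2 - s ≠ 0 := by linarith
    field_simp
    ring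
  have hasum : Summable fun n => amplitude n ^ p := by
    have := (Real.summable_one_div_nat_add_rpow 1 p).2 hp1
    refine this.congr fun n => ?_
    rw [amplitude, Real.div_rpow zero_le_one (by positivity), Real.one_rpow,
      abs_of_pos (by positivity)]
  refine ⟨(∑' n, amplitude n ^ p) ^ (s / p), ?_, ?_⟩
  · have : 0 ≤ ∑' n, amplitude n ^ p :=
      tsum_nonneg fun n => Real.rpow_nonneg (amplitude_pos n).le p
    positivity
  intro z v X Y hz hv hX hzs hzX hvY
  have hY : 0 ≤ Y := (hv 0).trans (hvY 0)
  obtain ⟨h1, h2⟩ := Real.summable_and_Lr_rpow_le_Lp_mul_Lq_tsum_of_nonneg htri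
    (fun n => (amplitude_pos n).le) hz hasum (by simpa using hzs)
  have hle : ∀ n, (amplitude n * z n * v n) ^ s ≤ (amplitude n * z n) ^ s * Y ^ s := fun n => by
    have ha := (amplitude_pos n).le
    have := hz n
    rw [← Real.mul_rpow (by positivity) hY]
    have := hv n
    have := hvY n
    gcongr
  have hsum : Summable fun n => (amplitude n * z n * v n) ^ s :=
    Summable.of_nonneg_of_le (fun n => by
      have ha := (amplitude_pos n).le
      have := hz n
      have := hv n
      positivity) hle (h1.mul_right _)
  refine ⟨hsum, (hsum.tsum_le_tsum hle (h1.mul_right _)).trans ?_⟩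
  rw [tsum_mul_right, Real.mul_rpow hX hY, ← mul_assoc]
  have h3 : (∑' n, z n ^ (2 : ℝ)) ^ (s / 2) ≤ X ^ s := by
    have h4 : ∑' n, z n ^ (2 : ℝ) ≤ X ^ 2 := by simpa using hzX
    calc (∑' n, z n ^ (2 : ℝ)) ^ (s / 2) ≤ (X ^ 2) ^ (s / 2) :=
          Real.rpow_le_rpow (tsum_nonneg fun n => Real.rpow_nonneg (hz n) _) h4 (by linarith)
      _ = X ^ s := by
        rw [← Real.rpow_natCast, ← Real.rpow_mul hX]
        congr 1
        push_cast
        ring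
  have h5 : 0 ≤ ∑' n, amplitude n ^ p :=
    tsum_nonneg fun n => Real.rpow_nonneg (amplitude_pos n).le p
  have hYs : 0 ≤ Y ^ s := by positivity
  exact mul_le_mul_of_nonneg_right (h2.trans (by gcongr)) hYs

lemma exists_ellTwo_mul {m : ℕ → ℂ} (hm : ∀ j, ‖m j‖ ≤ 1) (x : EllTwo) :
    ∃ z : EllTwo, (∀ j, z j = m j * x j) ∧ ‖z‖ ≤ ‖x‖ := by
  refine exists_ellTwo_of_sum_sq_le (norm_nonneg _) fun F => ?_
  refine le_trans (Finset.sum_le_sum fun j _ => ?_) (sum_norm_sq_le x F)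
  rw [norm_mul, mul_pow]
  exact mul_le_of_le_one_left (by positivity) (pow_le_one₀ (norm_nonneg _) (hm j))

/-- Coordinatewise, `∑ₙ bumpₙ² ≤ ∑ₙ bumpₙ ≤ 1`. -/
lemma exists_ellTwo_bump_mul {m : ℕ → ℕ → ℂ} (hm : ∀ n j, ‖m n j‖ ≤ bump n j) (x : EllTwo) :
    ∃ z : ℕ → EllTwo, (∀ n j, z n j = m n j * x j) ∧ (Summable fun n => ‖z n‖ ^ 2) ∧
      ∑' n, ‖z n‖ ^ 2 ≤ ‖x‖ ^ 2 := by
  choose z hz _ using fun n => exists_ellTwo_mul (fun j => (hm n j).trans (bump_le_one n j)) x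
  have hle : ∀ G : Finset ℕ, ∑ n ∈ G, ‖z n‖ ^ 2 ≤ ‖x‖ ^ 2 := by
    intro G
    have h1 := hasSum_sum (s := G) fun n (_ : n ∈ G) => hasSum_norm_sq (z n)
    refine hasSum_le (fun j => ?_) h1 (hasSum_norm_sq x)
    calc ∑ n ∈ G, ‖z n j‖ ^ 2 ≤ ∑ n ∈ G, bump n j * ‖x j‖ ^ 2 := by
          refine Finset.sum_le_sum fun n _ => ?_
          rw [hz, norm_mul, mul_pow]
          gcongr
          calc ‖m n j‖ ^ 2 ≤ bump n j ^ 2 := by gcongr; exact hm n j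
            _ ≤ bump n j := by nlinarith [bump_nonneg n j, bump_le_one n j]
      _ = (∑ n ∈ G, bump n j) * ‖x j‖ ^ 2 := by rw [Finset.sum_mul]
      _ ≤ ‖x j‖ ^ 2 := mul_le_of_le_one_left (by positivity) (sum_bump_le_one G j)
  exact ⟨z, hz, summable_of_sum_le (fun n => by positivity) hle,
    (summable_of_sum_le (fun n => by positivity) hle).tsum_le_of_sum_le hle⟩

lemma norm_node_pow (n j : ℕ) : ‖node n ^ j‖ = 1 := by rw [norm_pow, norm_node, one_pow]

/-- The Hankel matrix with entries `symbolCoeff (j + k)`. -/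
def symbolMatrix : Matrix ℕ ℕ ℂ := Matrix.of fun j k => symbolCoeff (j + k)

/-- The two terms of `bump_add` give `P`, with the bump on `x`, and `Q`, with the bump on `y`. The
unimodular `node n ^ (j + k)` factors over `j` and `k` and does not change norms. -/
theorem exists_atomicMultiplier_symbolMatrix {s : ℝ} (hs : 2 / 3 < s) (hs1 : s ≤ 1) :
    ∃ C, 0 ≤ C ∧ AtomicMultiplier s C symbolMatrix := by
  obtain ⟨W, hW, hbound⟩ := exists_norm_mul_rpow_bound hs hs1
  refine ⟨W + W, by positivity, fun x y => ?_⟩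
  have hbn : ∀ n j, ‖(bump n j : ℂ)‖ = bump n j := fun n j => by
    rw [Complex.norm_real, Real.norm_of_nonneg (bump_nonneg n j)]
  have hdn : ∀ n j, ‖(damp n j : ℂ)‖ ≤ 1 := fun n j => by
    rw [Complex.norm_real, Real.norm_of_nonneg (damp_pos n j).le]
    exact damp_le_one n j
  have hterm : ∀ n, ∀ m : ℕ → ℂ, (∀ j, ‖m j‖ ≤ 1) → ∀ j, ‖m j * node n ^ j‖ ≤ 1 := by
    intro n m hm j
    rw [norm_mul, norm_node_pow, mul_one]
    exact hm j
  obtain ⟨z, hz, hzs, hzx⟩ := exists_ellTwo_bump_mul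
    (m := fun n j => (bump n j : ℂ) * node n ^ j)
    (fun n j => by rw [norm_mul, norm_node_pow, mul_one, hbn]) x
  choose v hv hvy using fun n => exists_ellTwo_mul (m := fun j =>
    (starRingEnd ℂ) ((damp n j : ℂ) * node n ^ j))
    (fun j => by rw [RCLike.norm_conj]; exact hterm n _ (hdn n) j) y
  choose z' hz' hzx' using fun n => exists_ellTwo_mul (m := fun j =>
    (damp n j : ℂ) ^ 2 * node n ^ j)
    (hterm n _ (fun j => by rw [norm_pow]; exact pow_le_one₀ (norm_nonneg _) (hdn n j))) x
  obtain ⟨v', hv', hvs', hvy'⟩ := exists_ellTwo_bump_mul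
    (m := fun n j => (starRingEnd ℂ) ((bump n j : ℂ) * node n ^ j))
    (fun n j => by rw [RCLike.norm_conj, norm_mul, norm_node_pow, mul_one, hbn]) y
  have hsmul : ∀ n (w : EllTwo), ‖(amplitude n : ℂ) • w‖ = amplitude n * ‖w‖ := fun n w => by
    rw [norm_smul, Complex.norm_real, Real.norm_of_nonneg (amplitude_pos n).le]
  have hsumm : ∀ (e : ℕ → ℂ) (j : ℕ) (c : ℂ), (∀ n, ‖e n‖ ≤ bump n j) →
      Summable fun n => e n * c := fun e j c he =>
    (Summable.of_norm_bounded (summable_bump j) he).mul_right c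
  set P : Matrix ℕ ℕ ℂ := Matrix.of fun j k =>
    ∑' n, (((amplitude n : ℂ) • z n : EllTwo) j * (starRingEnd ℂ) (v n k)) with hP
  set Q : Matrix ℕ ℕ ℂ := Matrix.of fun j k =>
    ∑' n, (((amplitude n : ℂ) • z' n : EllTwo) j * (starRingEnd ℂ) (v' n k)) with hQ
  have hPt : ∀ j k n, ((amplitude n : ℂ) • z n : EllTwo) j * (starRingEnd ℂ) (v n k) =
      (amplitude n * bump n j * damp n k) * node n ^ (j + k) *
        (x j * (starRingEnd ℂ) (y k)) := by
    intro j k n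
    rw [lp.coeFn_smul, Pi.smul_apply, hz, hv, map_mul, Complex.conj_conj, smul_eq_mul, pow_add]
    ring
  have hQt : ∀ j k n, ((amplitude n : ℂ) • z' n : EllTwo) j * (starRingEnd ℂ) (v' n k) =
      (amplitude n * damp n j ^ 2 * bump n k) * node n ^ (j + k) *
        (x j * (starRingEnd ℂ) (y k)) := by
    intro j k n
    rw [lp.coeFn_smul, Pi.smul_apply, hz', hv', map_mul, Complex.conj_conj, smul_eq_mul, pow_add]
    ring
  have han : ∀ n, ‖(amplitude n : ℂ)‖ ≤ 1 := fun n => by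
    rw [Complex.norm_real, Real.norm_of_nonneg (amplitude_pos n).le]
    exact amplitude_le_one n
  have hPs : ∀ j k, HasSum (fun n => ((amplitude n : ℂ) • z n : EllTwo) j *
      (starRingEnd ℂ) (v n k)) (P j k) := by
    intro j k
    refine Summable.hasSum ?_
    simp only [hPt]
    refine hsumm _ j _ fun n => ?_
    rw [norm_mul, norm_node_pow, mul_one, norm_mul, norm_mul, hbn]
    calc ‖(amplitude n : ℂ)‖ * bump n j * ‖(damp n k : ℂ)‖ ≤ 1 * bump n j * 1 := by
          have := bump_nonneg n j
          gcongr
          exacts [han n, hdn n k]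
      _ = _ := by ring
  have hQs : ∀ j k, HasSum (fun n => ((amplitude n : ℂ) • z' n : EllTwo) j *
      (starRingEnd ℂ) (v' n k)) (Q j k) := by
    intro j k
    refine Summable.hasSum ?_
    simp only [hQt]
    refine hsumm _ k _ fun n => ?_
    rw [norm_mul, norm_node_pow, mul_one, norm_mul, norm_mul, hbn, norm_pow]
    calc ‖(amplitude n : ℂ)‖ * ‖(damp n j : ℂ)‖ ^ 2 * bump n k ≤ 1 * 1 ^ 2 * bump n k := by
          have := bump_nonneg n k
          gcongr
          exacts [han n, hdn n j]
      _ = _ := by ring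
  have hPa : AtomicBound s (W * (‖x‖ * ‖y‖) ^ s) P := by
    obtain ⟨h1, h2⟩ := hbound (fun n => ‖z n‖) (fun n => ‖v n‖) ‖x‖ ‖y‖ (fun n => norm_nonneg _)
      (fun n => norm_nonneg _) (norm_nonneg _) hzs hzx hvy
    refine ⟨ℕ, fun n => (amplitude n : ℂ) • z n, v, ?_, ?_, hPs⟩
    · simpa only [hsmul] using h1
    · simpa only [hsmul] using h2
  have hQa : AtomicBound s (W * (‖x‖ * ‖y‖) ^ s) Q := by
    obtain ⟨h1, h2⟩ := hbound (fun n => ‖v' n‖) (fun n => ‖z' n‖) ‖y‖ ‖x‖ (fun n => norm_nonneg _)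
      (fun n => norm_nonneg _) (norm_nonneg _) hvs' hvy' hzx'
    have hcomm : ∀ n, amplitude n * ‖z' n‖ * ‖v' n‖ = amplitude n * ‖v' n‖ * ‖z' n‖ :=
      fun n => by ring
    refine ⟨ℕ, fun n => (amplitude n : ℂ) • z' n, v', ?_, ?_, hQs⟩
    · simpa only [hsmul, hcomm] using h1
    · simpa only [hsmul, hcomm, mul_comm ‖x‖] using h2
  have hPQ : (Matrix.of fun j k => symbolMatrix j k * (x j * (starRingEnd ℂ) (y k))) = P + Q := by
    ext j k
    refine ((hasSum_symbolCoeff (j + k)).mul_right (x j * (starRingEnd ℂ) (y k))).unique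
      (hasSum_of_forall_eq (fun n => ?_) ((hPs j k).add (hQs j k)))
    rw [hPt, hQt, bump_add]
    push_cast
    ring
  rw [hPQ, add_mul]
  exact hPa.add hQa

/-! ### Power series in the unit disk -/

lemma hasFPowerSeriesOnBall_of_bounded {c : ℕ → ℂ} {K : ℝ} (hc : ∀ n, ‖c n‖ ≤ K) {f : ℂ → ℂ}
    (hf : ∀ z ∈ Metric.ball (0 : ℂ) 1, HasSum (fun n => c n * z ^ n) (f z)) :
    HasFPowerSeriesOnBall f (FormalMultilinearSeries.ofScalars ℂ c) 0 1 := by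
  refine ⟨?_, zero_lt_one, fun {y} hy => ?_⟩
  · refine FormalMultilinearSeries.le_radius_of_bound (r := 1) _ K fun n => ?_
    rw [FormalMultilinearSeries.ofScalars_norm]
    simpa using hc n
  · have hy' : y ∈ Metric.ball (0 : ℂ) 1 := by
      have h : (1 : ENNReal) = ENNReal.ofReal 1 := by simp
      rwa [h, Metric.eball_ofReal] at hy
    rw [zero_add]
    refine hasSum_of_forall_eq (fun n => ?_) (hf y hy')
    rw [FormalMultilinearSeries.ofScalars_apply_eq, smul_eq_mul]

lemma taylorCoeff_eq_of_bounded {c : ℕ → ℂ} {K : ℝ} (hc : ∀ n, ‖c n‖ ≤ K) {f : ℂ → ℂ}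
    (hf : ∀ z ∈ Metric.ball (0 : ℂ) 1, HasSum (fun n => c n * z ^ n) (f z)) (n : ℕ) :
    taylorCoeff f n = c n := by
  have h1 := hasFPowerSeriesOnBall_of_bounded hc hf
  have h2 := h1.analyticAt.hasFPowerSeriesAt.eq_formalMultilinearSeries h1.hasFPowerSeriesAt
  exact congrFun (FormalMultilinearSeries.ofScalars_series_injective ℂ ℂ h2) n

lemma hasSum_bounded_mul_pow {c : ℕ → ℂ} {K : ℝ} (hc : ∀ n, ‖c n‖ ≤ K) {z : ℂ}
    (hz : z ∈ Metric.ball (0 : ℂ) 1) : HasSum (fun n => c n * z ^ n) (∑' n, c n * z ^ n) := by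
  rw [mem_ball_zero_iff] at hz
  refine (Summable.of_norm_bounded
    ((summable_geometric_of_lt_one (norm_nonneg z) hz).mul_left K) fun n => ?_).hasSum
  rw [norm_mul, norm_pow]
  exact mul_le_mul_of_nonneg_right (hc n) (by positivity)

/-! ### Cauchy integrals of measures -/

lemma integral_const_mul (μ : ComplexMeasure UnitCircle) (c : ℂ) (f : UnitCircle → ℂ) :
    μ.integral (fun τ => c * f τ) (ContinuousLinearMap.mul ℝ ℂ) =
      c * μ.integral f (ContinuousLinearMap.mul ℝ ℂ) :=
  setToFun_smul _ (fun c s x => by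
    change c * x * μ s = c * (x * μ s)
    ring) c f

lemma norm_conj_coe (τ : UnitCircle) : ‖(starRingEnd ℂ) (τ : ℂ)‖ = 1 := by
  rw [RCLike.norm_conj]
  exact mem_sphere_zero_iff_norm.1 τ.2

lemma continuous_conj_coe : Continuous fun τ : UnitCircle => (starRingEnd ℂ) (τ : ℂ) :=
  Complex.continuous_conj.comp continuous_subtype_val

lemma one_sub_conj_mul_ne_zero (τ : UnitCircle) {ζ : ℂ} (hζ : ζ ∈ Metric.ball (0 : ℂ) 1) :
    1 - (starRingEnd ℂ) (τ : ℂ) * ζ ≠ 0 := by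
  rw [mem_ball_zero_iff] at hζ
  intro h
  have h1 : ‖(starRingEnd ℂ) (τ : ℂ) * ζ‖ = 1 := by
    rw [← sub_eq_zero.1 h, norm_one]
  rw [norm_mul, norm_conj_coe, one_mul] at h1
  exact hζ.ne h1

/-- The kernel has modulus at least `1 / 2`, so its integrability would force finite variation.
Otherwise the integral takes its default value `0`. -/
lemma cauchyIntegral_eq_zero_of_not_isFiniteMeasure {μ : ComplexMeasure UnitCircle}
    (hμ : ¬ IsFiniteMeasure μ.variation) {ζ : ℂ} (hζ : ζ ∈ Metric.ball (0 : ℂ) 1) :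
    cauchyIntegral μ ζ = 0 := by
  refine VectorMeasure.integral_undef fun h => hμ ?_
  have h1 : Integrable (fun _ : UnitCircle => (1 / 2 : ℝ)) μ.variation := by
    refine Integrable.mono h aestronglyMeasurable_const (Filter.Eventually.of_forall fun τ => ?_)
    have h2 : ‖1 - (starRingEnd ℂ) (τ : ℂ) * ζ‖ ≤ 2 := by
      refine (norm_sub_le _ _).trans ?_
      rw [norm_mul, norm_conj_coe, norm_one]
      rw [mem_ball_zero_iff] at hζ
      linarith
    have h3 : 0 < ‖1 - (starRingEnd ℂ) (τ : ℂ) * ζ‖ :=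
      norm_pos_iff.2 (one_sub_conj_mul_ne_zero τ hζ)
    rw [norm_inv, Real.norm_of_nonneg (by norm_num), one_div]
    exact inv_anti₀ h3 h2
  exact (integrable_const_iff.1 h1).resolve_left (by norm_num)

lemma hasSum_cauchyIntegral (μ : ComplexMeasure UnitCircle) [IsFiniteMeasure μ.variation] {ζ : ℂ}
    (hζ : ζ ∈ Metric.ball (0 : ℂ) 1) :
    HasSum (fun n : ℕ => μ.integral (fun τ => (starRingEnd ℂ) (τ : ℂ) ^ n)
      (ContinuousLinearMap.mul ℝ ℂ) * ζ ^ n) (cauchyIntegral μ ζ) := by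
  have hζ' : ‖ζ‖ < 1 := mem_ball_zero_iff.1 hζ
  have hn : ∀ τ : UnitCircle, ‖(starRingEnd ℂ) (τ : ℂ) * ζ‖ = ‖ζ‖ := fun τ => by
    rw [norm_mul, norm_conj_coe, one_mul]
  have hmeas : ∀ n : ℕ, AEStronglyMeasurable
      (fun τ : UnitCircle => ((starRingEnd ℂ) (τ : ℂ) * ζ) ^ n) μ.variation := fun n =>
    ((continuous_conj_coe.mul continuous_const).pow n).aestronglyMeasurable
  have hbound : ∀ (n : ℕ) (τ : UnitCircle),
      ‖((starRingEnd ℂ) (τ : ℂ) * ζ) ^ n‖ ≤ ‖ζ‖ ^ n := fun n τ => by rw [norm_pow, hn]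
  have hlim : ∀ τ : UnitCircle, HasSum (fun n : ℕ => ((starRingEnd ℂ) (τ : ℂ) * ζ) ^ n)
      (1 - (starRingEnd ℂ) (τ : ℂ) * ζ)⁻¹ := fun τ =>
    hasSum_geometric_of_norm_lt_one (by rwa [hn])
  have h1 : HasSum (fun n : ℕ => μ.integral (fun τ => ((starRingEnd ℂ) (τ : ℂ) * ζ) ^ n)
      (ContinuousLinearMap.mul ℝ ℂ)) (cauchyIntegral μ ζ) :=
    VectorMeasure.hasSum_integral_of_dominated_convergence (fun n _ => ‖ζ‖ ^ n) hmeas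
      (fun n => Filter.Eventually.of_forall (hbound n))
      (Filter.Eventually.of_forall fun _ => summable_geometric_of_lt_one (norm_nonneg _) hζ')
      (integrable_const _) (Filter.Eventually.of_forall hlim)
  refine hasSum_of_forall_eq (fun n => ?_) h1
  rw [mul_comm, ← integral_const_mul]
  congr 1
  ext τ
  ring

/-- The pairing of the Taylor coefficients of a Cauchy integral with a trigonometric polynomial
is controlled by the integral of the polynomial against a finite positive measure. -/
lemma IsCauchyIntegralOfMeasure.exists_measure {φ : ℂ → ℂ} (hφ : IsCauchyIntegralOfMeasure φ)
    {c : ℕ → ℂ} {K : ℝ} (hc : ∀ n, ‖c n‖ ≤ K)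
    (hf : ∀ z ∈ Metric.ball (0 : ℂ) 1, HasSum (fun n => c n * z ^ n) (φ z)) :
    ∃ ν : Measure UnitCircle, IsFiniteMeasure ν ∧ ∀ (F : Finset ℕ) (b : ℕ → ℂ),
      ‖∑ j ∈ F, b j * c j‖ ≤ ∫ τ : UnitCircle, ‖∑ j ∈ F, b j * (starRingEnd ℂ) (τ : ℂ) ^ j‖ ∂ν := by
  obtain ⟨μ, hμ⟩ := hφ
  by_cases hfin : IsFiniteMeasure μ.variation
  · set m : ℕ → ℂ := fun n => μ.integral (fun τ => (starRingEnd ℂ) (τ : ℂ) ^ n)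
      (ContinuousLinearMap.mul ℝ ℂ) with hm
    have hpow : ∀ (n : ℕ) (τ : UnitCircle), ‖(starRingEnd ℂ) (τ : ℂ) ^ n‖ ≤ 1 := fun n τ => by
      rw [norm_pow, norm_conj_coe, one_pow]
    have hmb : ∀ n, ‖m n‖ ≤ 1 * ‖ContinuousLinearMap.mul ℝ ℂ‖ * μ.variation.real Set.univ :=
      fun n => VectorMeasure.norm_integral_le_of_norm_le_const
        (Filter.Eventually.of_forall (hpow n))
    -- Both sequences are Taylor coefficients of `φ`: expanding the kernel geometrically shows that
    -- these are the moments of `μ`.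
    have hcm : ∀ n, c n = m n := fun n => by
      rw [← taylorCoeff_eq_of_bounded hc hf, ← taylorCoeff_eq_of_bounded hmb fun z hz => ?_]
      rw [hμ z hz]
      exact hasSum_cauchyIntegral μ hz
    refine ⟨μ.variation, hfin, fun F b => ?_⟩
    have hint : ∀ j ∈ F, μ.Integrable fun τ : UnitCircle => b j * (starRingEnd ℂ) (τ : ℂ) ^ j := by
      intro j _
      refine Integrable.const_mul ?_ (b j)
      exact Integrable.of_bound (continuous_conj_coe.pow j).aestronglyMeasurable 1
        (Filter.Eventually.of_forall (hpow j))
    have heq : ∑ j ∈ F, b j * c j =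
        μ.integral (fun τ => ∑ j ∈ F, b j * (starRingEnd ℂ) (τ : ℂ) ^ j)
          (ContinuousLinearMap.mul ℝ ℂ) := by
      rw [VectorMeasure.integral_finsetSum F hint]
      exact Finset.sum_congr rfl fun j _ => by rw [integral_const_mul, hcm]
    rw [heq]
    refine VectorMeasure.norm_integral_le_integral_norm.trans ?_
    refine mul_le_of_le_one_left (integral_nonneg fun _ => norm_nonneg _) ?_
    exact ContinuousLinearMap.opNorm_mul_le ℝ ℂ
  -- Here the Cauchy integral vanishes on the disk, so all coefficients are zero and the zero
  -- measure serves.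
  · refine ⟨0, inferInstance, fun F b => ?_⟩
    have h0 : ∀ n, c n = 0 := fun n => by
      rw [← taylorCoeff_eq_of_bounded hc hf,
        taylorCoeff_eq_of_bounded (c := fun _ => 0) (K := 0) (by simp) fun z hz => ?_]
      rw [hμ z hz, cauchyIntegral_eq_zero_of_not_isFiniteMeasure hfin hz]
      simp
    simp [h0]

/-! ### The symbol is not a Cauchy integral -/

/-- The frequencies of the test polynomial at scale `n`. -/
def testIndices (n : ℕ) : Finset ℕ := Finset.Ico (2 ^ n ^ 2) (2 * 2 ^ n ^ 2)

/-- The coefficients of the test polynomial at scale `n`. -/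
def testCoeff (n j : ℕ) : ℂ := (scale n : ℂ)⁻¹ * (starRingEnd ℂ) (node n) ^ j

lemma card_testIndices (n : ℕ) : ((testIndices n).card : ℝ) = scale n := by
  rw [testIndices, Nat.card_Ico, scale]
  have : 2 * 2 ^ n ^ 2 - 2 ^ n ^ 2 = 2 ^ n ^ 2 := by omega
  rw [this]
  push_cast
  rfl

lemma scale_le_of_mem {n j : ℕ} (hj : j ∈ testIndices n) : scale n ≤ j := by
  rw [testIndices, Finset.mem_Ico] at hj
  rw [scale]
  exact_mod_cast hj.1

lemma le_two_mul_scale_of_mem {n j : ℕ} (hj : j ∈ testIndices n) : j ≤ 2 * scale n := by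
  rw [testIndices, Finset.mem_Ico] at hj
  rw [scale]
  exact_mod_cast hj.2.le

lemma norm_testCoeff (n j : ℕ) : ‖testCoeff n j‖ = (scale n)⁻¹ := by
  rw [testCoeff, norm_mul, norm_pow, RCLike.norm_conj, norm_node, one_pow, mul_one, norm_inv,
    Complex.norm_real, Real.norm_of_nonneg (scale_pos n).le]

lemma norm_sum_testCoeff_mul_le {n : ℕ} {f : ℕ → ℂ} {C : ℝ}
    (hf : ∀ j ∈ testIndices n, ‖f j‖ ≤ C) : ‖∑ j ∈ testIndices n, testCoeff n j * f j‖ ≤ C := by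
  refine (norm_sum_le_of_le _ (fun j hj => ?_)).trans_eq
    (?_ : ∑ j ∈ testIndices n, (scale n)⁻¹ * C = C)
  · rw [norm_mul, norm_testCoeff]
    exact mul_le_mul_of_nonneg_left (hf j hj) (inv_nonneg.2 (scale_pos n).le)
  · rw [Finset.sum_const, nsmul_eq_mul, card_testIndices, mul_inv_cancel_left₀ (scale_pos n).ne']

lemma two_pow_mul_two_pow_le (n : ℕ) : (2 : ℝ) ^ n * 2 ^ n ≤ 2 * scale n := by
  rw [scale, ← pow_add, ← pow_succ']
  exact pow_le_pow_right₀ one_le_two (by nlinarith [sq_nonneg ((n : ℤ) - 1)])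

/-- A geometric sum with ratio `u`, where `|u - 1|` is at least the gap `2 ^ (-n) / 4` between
imaginary parts, is at most `8 · 2 ^ n`. Dividing by `scale n ≥ 4 ^ n / 2` gives `16 · 2 ^ (-n)`. -/
lemma norm_test_le (n : ℕ) {w : ℂ} (hw : ‖w‖ = 1)
    (hgap : (1 / 2 : ℝ) ^ n / 4 ≤ |(-w.im) - (1 / 2) ^ n|) :
    ‖∑ j ∈ testIndices n, testCoeff n j * (starRingEnd ℂ) w ^ j‖ ≤ 16 * (1 / 2) ^ n := by
  set u : ℂ := (starRingEnd ℂ) (node n) * (starRingEnd ℂ) w with hu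
  have hun : ‖u‖ = 1 := by
    rw [hu, norm_mul, RCLike.norm_conj, RCLike.norm_conj, norm_node, hw, one_mul]
  have hsub : u - 1 = (starRingEnd ℂ) (node n) * ((starRingEnd ℂ) w - node n) := by
    rw [mul_sub, Complex.conj_mul', norm_node]
    simp [hu]
  have hgap' : (1 / 2 : ℝ) ^ n / 4 ≤ ‖u - 1‖ := by
    rw [hsub, norm_mul, RCLike.norm_conj, norm_node, one_mul]
    refine hgap.trans ?_
    simpa [node] using Complex.abs_im_le_norm ((starRingEnd ℂ) w - node n)
  set S : ℂ := ∑ j ∈ testIndices n, u ^ j with hS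
  have hprod : ‖S‖ * ‖u - 1‖ ≤ 2 := by
    rw [← norm_mul, hS, testIndices, geom_sum_Ico_mul u (by omega)]
    refine (norm_sub_le _ _).trans ?_
    rw [norm_pow, norm_pow, hun, one_pow, one_pow]
    norm_num
  have hSq : ‖S‖ * (1 / 2 : ℝ) ^ n ≤ 8 := by
    nlinarith [mul_le_mul_of_nonneg_left hgap' (norm_nonneg S)]
  have heq : ∑ j ∈ testIndices n, testCoeff n j * (starRingEnd ℂ) w ^ j = (scale n : ℂ)⁻¹ * S := by
    rw [hS, Finset.mul_sum]
    refine Finset.sum_congr rfl fun j _ => ?_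
    rw [testCoeff, hu, mul_pow, mul_assoc]
  have hs := scale_pos n
  rw [heq, norm_mul, norm_inv, Complex.norm_real, Real.norm_of_nonneg hs.le,
    inv_mul_le_iff₀ hs]
  have h2 := two_pow_mul_two_pow_le n
  have hq : (0 : ℝ) < 2 ^ n := by positivity
  rw [one_div, inv_pow] at hSq ⊢
  rw [← div_eq_mul_inv, div_le_iff₀ hq] at hSq
  rw [← mul_assoc, ← div_eq_mul_inv, le_div_iff₀ hq]
  nlinarith

/-- The intervals of relative radius `1/4` around the numbers `2 ^ (-n)` are disjoint, so at most
one `n` escapes `norm_test_le`, and it contributes at most `1`. The others sum to at most `16 · 2`.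
-/
lemma sum_norm_test_le (M : ℕ) (τ : UnitCircle) :
    ∑ n ∈ Finset.range M,
      ‖∑ j ∈ testIndices n, testCoeff n j * (starRingEnd ℂ) (τ : ℂ) ^ j‖ ≤ 33 := by
  classical
  have hτ : ‖(τ : ℂ)‖ = 1 := mem_sphere_zero_iff_norm.1 τ.2
  set bad : Finset ℕ := (Finset.range M).filter fun n =>
    |(-(τ : ℂ).im) - (1 / 2) ^ n| < (1 / 2 : ℝ) ^ n / 4 with hbad
  have hcard : bad.card ≤ 1 := by
    have hlt : ∀ a b : ℕ, a < b → a ∈ bad → b ∉ bad := by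
      intro a b hab ha hb
      rw [hbad, Finset.mem_filter, abs_lt] at ha hb
      have h1 : (1 / 2 : ℝ) ^ b ≤ (1 / 2) ^ (a + 1) :=
        pow_le_pow_of_le_one (by norm_num) (by norm_num) hab
      rw [pow_succ] at h1
      have h2 : (0 : ℝ) < (1 / 2) ^ a := by positivity
      linarith [ha.2.1, hb.2.2]
    refine Finset.card_le_one.2 fun a ha b hb => ?_
    rcases lt_trichotomy a b with h | h | h
    · exact absurd hb (hlt a b h ha)
    · exact h
    · exact absurd ha (hlt b a h hb)
  have hterm : ∀ n ∈ Finset.range M,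
      ‖∑ j ∈ testIndices n, testCoeff n j * (starRingEnd ℂ) (τ : ℂ) ^ j‖ ≤
        16 * (1 / 2) ^ n + if n ∈ bad then 1 else 0 := by
    intro n hn
    split_ifs with h
    · have h1 : ‖∑ j ∈ testIndices n, testCoeff n j * (starRingEnd ℂ) (τ : ℂ) ^ j‖ ≤ 1 :=
        norm_sum_testCoeff_mul_le fun j _ => by rw [norm_pow, norm_conj_coe, one_pow]
      have h2 : (0 : ℝ) < (1 / 2) ^ n := by positivity
      linarith
    · rw [add_zero]
      refine norm_test_le n hτ (not_lt.1 fun h' => h ?_)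
      rw [hbad, Finset.mem_filter]
      exact ⟨hn, h'⟩
  refine (Finset.sum_le_sum hterm).trans ?_
  rw [Finset.sum_add_distrib, ← Finset.mul_sum, Finset.sum_ite_mem, Finset.sum_const,
    nsmul_eq_mul, mul_one]
  have h1 : ∑ n ∈ Finset.range M, (1 / 2 : ℝ) ^ n ≤ 2 :=
    (summable_geometric_two.sum_le_tsum _ fun _ _ => by positivity).trans_eq tsum_geometric_two
  have h2 : ((Finset.range M ∩ bad).card : ℝ) ≤ 1 := by
    exact_mod_cast (Finset.card_le_card Finset.inter_subset_right).trans hcard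
  linarith

/-- For `a < b` one has `a² + a + b ≤ b²`. The quadratic exponent gives decay in both indices, so
interactions between scales stay small after summing over one of them. -/
lemma scale_mul_le_scale {a b : ℕ} (hab : a < b) : scale a * (2 ^ a * 2 ^ b) ≤ scale b := by
  rw [scale, scale, ← pow_add, ← pow_add]
  exact pow_le_pow_right₀ one_le_two (by nlinarith)

lemma scale_div_scale_le {a b : ℕ} (hab : a < b) :
    scale a / scale b ≤ (1 / 2) ^ a * (1 / 2) ^ b := by
  rw [div_le_iff₀ (scale_pos b), one_div, inv_pow, inv_pow, ← mul_inv, ← div_eq_inv_mul,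
    le_div_iff₀ (by positivity)]
  exact scale_mul_le_scale hab

/-- If `m < n`, then `j` is far beyond `scale m` and `exp (-t) ≤ 1 / t` applies. If `m > n`, then
`j` is far below `scale m` and `1 - exp (-t) ≤ t` applies. -/
lemma bump_le_of_ne {m n j : ℕ} (hmn : m ≠ n) (hj : j ∈ testIndices n) :
    bump m j ≤ 2 * ((1 / 2) ^ m * (1 / 2) ^ n) := by
  have hm := scale_pos m
  have hn := scale_pos n
  have hj1 := scale_le_of_mem hj
  have hj2 := le_two_mul_scale_of_mem hj
  have hd := damp_pos m j
  have hd1 := damp_le_one m j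
  rcases hmn.lt_or_gt with h | h
  · have h1 : damp m j ≤ scale m / scale n := by
      have hx := Real.add_one_le_exp ((j : ℝ) / scale m)
      rw [damp, Real.exp_neg, ← inv_div (scale n)]
      have : scale n / scale m ≤ j / scale m := by gcongr
      exact inv_anti₀ (div_pos hn hm) (by linarith)
    have h2 := scale_div_scale_le h
    have h3 : (0 : ℝ) < (1 / 2) ^ m * (1 / 2) ^ n := by positivity
    rw [bump]
    nlinarith
  · have h1 : 1 - damp m j ≤ 2 * (scale n / scale m) := by
      have hx := Real.add_one_le_exp (-((j : ℝ) / scale m))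
      have : (j : ℝ) / scale m ≤ 2 * scale n / scale m := by gcongr
      rw [mul_div_assoc] at this
      rw [damp]
      linarith
    have h2 := scale_div_scale_le h
    rw [mul_comm ((1 / 2 : ℝ) ^ m)]
    rw [bump]
    nlinarith

lemma le_bump_of_mem {n j : ℕ} (hj : j ∈ testIndices n) :
    Real.exp (-2) * (1 - Real.exp (-1)) ≤ bump n j := by
  have hn := scale_pos n
  have h1 : Real.exp (-2) ≤ damp n j := by
    rw [damp, Real.exp_le_exp, neg_le_neg_iff, div_le_iff₀ hn]
    exact le_two_mul_scale_of_mem hj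
  have h2 : damp n j ≤ Real.exp (-1) := by
    rw [damp, Real.exp_le_exp, neg_le_neg_iff, le_div_iff₀ hn, one_mul]
    exact scale_le_of_mem hj
  have h3 : Real.exp (-1) < 1 := Real.exp_lt_one_iff.2 (by norm_num)
  have h4 : bump n j = damp n j * (1 - damp n j) := by
    rw [bump]
    ring
  rw [h4]
  exact mul_le_mul h1 (by linarith) (by linarith) (damp_pos n j).le

/-- In the term `m = n` the phases cancel, leaving an average of positive numbers at least `c₀ aₙ`.
The terms `m ≠ n` sum to at most `∑ₘ 2 · 2 ^ (-m) 2 ^ (-n) = 4 · 2 ^ (-n)`. -/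
lemma le_norm_test_symbol (n : ℕ) : Real.exp (-2) * (1 - Real.exp (-1)) * amplitude n ≤
    ‖∑ j ∈ testIndices n, testCoeff n j * symbolCoeff j‖ + 4 * (1 / 2) ^ n := by
  set c₀ := Real.exp (-2) * (1 - Real.exp (-1)) with hc₀
  set L : ℕ → ℂ := fun m => ∑ j ∈ testIndices n,
    testCoeff n j * (((amplitude m * bump m j : ℝ) : ℂ) * node m ^ j) with hL
  have hsum : HasSum L (∑ j ∈ testIndices n, testCoeff n j * symbolCoeff j) :=
    hasSum_sum fun j _ => (hasSum_symbolCoeff j).mul_left _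
  have hoff : ∀ m, ‖if m = n then 0 else L m‖ ≤ (1 / 2) ^ m * (2 * (1 / 2 : ℝ) ^ n) := by
    intro m
    split_ifs with h
    · rw [norm_zero]
      positivity
    · refine norm_sum_testCoeff_mul_le fun j hj => (norm_symbolCoeff_term_le m j).trans ?_
      refine (amplitude_mul_bump_le m j).trans ((bump_le_of_ne h hj).trans_eq ?_)
      ring
  have hrest : ‖∑' m, if m = n then 0 else L m‖ ≤ 4 * (1 / 2) ^ n := by
    refine (tsum_of_norm_bounded (hasSum_geometric_two.mul_right _) hoff).trans_eq ?_
    ring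
  have hdiag : L n = ((∑ j ∈ testIndices n, (scale n)⁻¹ * (amplitude n * bump n j) : ℝ) : ℂ) := by
    rw [hL, Complex.ofReal_sum]
    refine Finset.sum_congr rfl fun j _ => ?_
    have h1 : (starRingEnd ℂ) (node n) ^ j * node n ^ j = 1 := by
      rw [← mul_pow, Complex.conj_mul', norm_node]
      simp
    rw [testCoeff]
    push_cast
    linear_combination ((scale n : ℂ)⁻¹ * (amplitude n * bump n j)) * h1
  have hge : c₀ * amplitude n ≤ ‖L n‖ := by
    rw [hdiag, Complex.norm_real]
    refine le_trans ?_ (le_abs_self _)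
    calc c₀ * amplitude n = ∑ j ∈ testIndices n, (scale n)⁻¹ * (amplitude n * c₀) := by
          rw [Finset.sum_const, nsmul_eq_mul, card_testIndices,
            mul_inv_cancel_left₀ (scale_pos n).ne', mul_comm]
      _ ≤ _ := by
          have h1 := (scale_pos n).le
          have h2 := (amplitude_pos n).le
          refine Finset.sum_le_sum fun j hj => ?_
          gcongr
          exact le_bump_of_mem hj
  have hsplit := hsum.summable.tsum_eq_add_tsum_ite n
  rw [hsum.tsum_eq] at hsplit
  rw [hsplit]
  have := norm_sub_le (L n + ∑' m, if m = n then 0 else L m) (∑' m, if m = n then 0 else L m)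
  rw [add_sub_cancel_right] at this
  linarith

/-- The symbol. -/
def symbol (z : ℂ) : ℂ := ∑' n, symbolCoeff n * z ^ n

lemma hasSum_symbol {z : ℂ} (hz : z ∈ Metric.ball (0 : ℂ) 1) :
    HasSum (fun n => symbolCoeff n * z ^ n) (symbol z) :=
  hasSum_bounded_mul_pow norm_symbolCoeff_le_one hz

theorem not_isCauchyIntegralOfMeasure_symbol : ¬ IsCauchyIntegralOfMeasure symbol := by
  intro h
  obtain ⟨ν, hν, hbound⟩ := h.exists_measure norm_symbolCoeff_le_one fun z hz => hasSum_symbol hz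
  set c₀ := Real.exp (-2) * (1 - Real.exp (-1)) with hc₀
  have hc₀pos : 0 < c₀ := by
    have : Real.exp (-1) < 1 := Real.exp_lt_one_iff.2 (by norm_num)
    have := Real.exp_pos (-2)
    rw [hc₀]
    exact mul_pos this (by linarith)
  -- Summing the test pairings and integrating the pointwise bound gives `33 ν(𝕋)`; the errors `4 ·
  -- 2 ^ (-n)` add up to at most `8`.
  have hle : ∀ M, c₀ * ∑ n ∈ Finset.range M, amplitude n ≤ 33 * ν.real Set.univ + 8 := by
    intro M
    have hcont : ∀ n, Continuous fun τ : UnitCircle =>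
        ‖∑ j ∈ testIndices n, testCoeff n j * (starRingEnd ℂ) (τ : ℂ) ^ j‖ := fun n =>
      (continuous_finsetSum _ fun j _ => continuous_const.mul (continuous_conj_coe.pow j)).norm
    have hint : ∀ n ∈ Finset.range M, Integrable (fun τ : UnitCircle =>
        ‖∑ j ∈ testIndices n, testCoeff n j * (starRingEnd ℂ) (τ : ℂ) ^ j‖) ν := fun n hn =>
      Integrable.of_bound (hcont n).aestronglyMeasurable 33
        (Filter.Eventually.of_forall fun τ => by
          rw [norm_norm]
          refine le_trans ?_ (sum_norm_test_le M τ)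
          exact Finset.single_le_sum (f := fun n =>
            ‖∑ j ∈ testIndices n, testCoeff n j * (starRingEnd ℂ) (τ : ℂ) ^ j‖)
            (fun _ _ => norm_nonneg _) hn)
    calc c₀ * ∑ n ∈ Finset.range M, amplitude n
        ≤ ∑ n ∈ Finset.range M, ((∫ τ : UnitCircle,
            ‖∑ j ∈ testIndices n, testCoeff n j * (starRingEnd ℂ) (τ : ℂ) ^ j‖ ∂ν) +
            4 * (1 / 2) ^ n) := by
          rw [Finset.mul_sum]
          exact Finset.sum_le_sum fun n _ =>
            (le_norm_test_symbol n).trans (by gcongr; exact hbound _ _)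
      _ = (∫ τ : UnitCircle, ∑ n ∈ Finset.range M,
            ‖∑ j ∈ testIndices n, testCoeff n j * (starRingEnd ℂ) (τ : ℂ) ^ j‖ ∂ν) +
            4 * ∑ n ∈ Finset.range M, (1 / 2 : ℝ) ^ n := by
          rw [Finset.sum_add_distrib, integral_finsetSum _ hint, Finset.mul_sum]
      _ ≤ (∫ _ : UnitCircle, (33 : ℝ) ∂ν) + 4 * 2 := by
          gcongr
          · exact integrable_finsetSum _ hint
          · exact integrable_const _
          · exact fun τ => sum_norm_test_le M τ
          · exact (summable_geometric_two.sum_le_tsum _ fun _ _ => by positivity).trans_eq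
              tsum_geometric_two
      _ = _ := by
          rw [integral_const, smul_eq_mul]
          ring
  have htend := Real.tendsto_sum_range_one_div_nat_succ_atTop.const_mul_atTop hc₀pos
  obtain ⟨M, hM⟩ := (htend.eventually_gt_atTop (33 * ν.real Set.univ + 8)).exists
  exact absurd (hle M) (not_le.2 hM)

end HankelSchur

end

theorem theorem6 (p : ℝ) (hp : 2 / 3 < p) :
    ∃ ψ : ℂ → ℂ, AnalyticOnNhd ℂ ψ (Metric.ball (0 : ℂ) 1) ∧
      HankelSchur.IsSchurMultiplier p (HankelSchur.hankelMatrix ψ) ∧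
      ¬ HankelSchur.IsCauchyIntegralOfMeasure ψ := by
  open HankelSchur in
  have hsum := fun z (hz : z ∈ Metric.ball (0 : ℂ) 1) => hasSum_symbol hz
  refine ⟨symbol, ?_, ?_, not_isCauchyIntegralOfMeasure_symbol⟩
  · have := (hasFPowerSeriesOnBall_of_bounded norm_symbolCoeff_le_one hsum).analyticOnNhd
    have h : (1 : ENNReal) = ENNReal.ofReal 1 := by simp
    rwa [h, Metric.eball_ofReal] at this
  -- The exponent lies above `2/3` for the atomic bound, below `1` for the embedding in `ℓ^1`, and
  -- strictly below `p` for the interpolation.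
  · obtain ⟨s, hs, hsp⟩ := exists_between (lt_min hp (by norm_num : (2 / 3 : ℝ) < 1))
    obtain ⟨C, hC, hA⟩ := exists_atomicMultiplier_symbolMatrix hs (hsp.le.trans (min_le_right _ _))
    have heq : hankelMatrix symbol = symbolMatrix := by
      ext j k
      exact taylorCoeff_eq_of_bounded norm_symbolCoeff_le_one hsum (j + k)
    rw [heq]
    exact hA.isSchurMultiplier (by linarith) (hsp.le.trans (min_le_right _ _))
      (hsp.trans_le (min_le_left _ _)) hC
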